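/- Consider the intuitionistic predicate language with countably many individual variables, countably many predicate letters of every arity, $\bot$, $\wedge$, $\vee$, $\to$, $\forall$, $\exists$. Let $\mathbf{QLC}$ be the superintuitionistic predicate logic of linear Kripke frames, i.e. the set of all formulas $\varphi$ that are true in every intuitionistic Kripke model $\langle W,R,D,I\rangle$ in which $R$ is a linear order on the set of worlds $W\neq\varnothing$, the local domains $D_w$ are non-empty and expanding ($wRv$ implies $D_w\subseteq D_v$), and the interpretation of the predicate letters is hereditary; here $\varphi$ is true in the model if it is true at every world $w$ under every assignment that sends the free variables of $\varphi$ to elements of $D_w$. Fix two individual variables $x,y$ and one binary predicate letter. Then the two-variable fragment of $\mathbf{QLC}$, i.e. the set of formulas in $\mathbf{QLC}$ that contain no individual variables (free or bound) other than $x$ and $y$, is $\Sigma^0_1$-complete: its set of Gödel numbers is recursively enumerable, and every recursively enumerable set of natural numbers is many-one reducible to it. Moreover, the set of those formulas of this fragment whose predicate letters are all either unary or equal to the fixed binary letter is also $\Sigma^0_1$-complete. -/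

import Mathlib

namespace IntPred

/-- Formulas of the intuitionistic predicate language: individual variables are natural numbers,
and for every arity `n` there are countably many `n`-ary predicate letters, numbered by `i : ℕ`;
`atom n i x` is the `i`-th `n`-ary letter applied to the variables `x 0, …, x (n - 1)`. -/
inductive Formula : Type
  | bot : Formula
  | atom (n i : ℕ) (x : Fin n → ℕ) : Formula
  | and (φ ψ : Formula) : Formula
  | or (φ ψ : Formula) : Formula
  | imp (φ ψ : Formula) : Formula
  | all (x : ℕ) (φ : Formula) : Formula
  | ex (x : ℕ) (φ : Formula) : Formula

namespace Formula

/-- The variables with a free occurrence. -/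
def freeVars : Formula → Finset ℕ
  | bot => ∅
  | atom _ _ x => Finset.univ.image x
  | and φ ψ => φ.freeVars ∪ ψ.freeVars
  | or φ ψ => φ.freeVars ∪ ψ.freeVars
  | imp φ ψ => φ.freeVars ∪ ψ.freeVars
  | all x φ => φ.freeVars.erase x
  | ex x φ => φ.freeVars.erase x

/-- All variables occurring in a formula, free, bound, or next to a quantifier symbol. -/
def vars : Formula → Finset ℕ
  | bot => ∅
  | atom _ _ x => Finset.univ.image x
  | and φ ψ => φ.vars ∪ ψ.vars
  | or φ ψ => φ.vars ∪ ψ.vars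
  | imp φ ψ => φ.vars ∪ ψ.vars
  | all x φ => insert x φ.vars
  | ex x φ => insert x φ.vars

/-- The predicate letters occurring in a formula, as pairs (arity, number). -/
def letters : Formula → Finset (ℕ × ℕ)
  | bot => ∅
  | atom n i _ => {(n, i)}
  | and φ ψ => φ.letters ∪ ψ.letters
  | or φ ψ => φ.letters ∪ ψ.letters
  | imp φ ψ => φ.letters ∪ ψ.letters
  | all _ φ => φ.letters
  | ex _ φ => φ.letters

/-- A Gödel numbering of formulas, built on the Cantor-style pairing `Nat.pair` and Mathlib's
encoding of lists of natural numbers. -/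
def code : Formula → ℕ
  | bot => Nat.pair 0 0
  | atom _ i x => Nat.pair 1 (Nat.pair i (Encodable.encode (List.ofFn x)))
  | and φ ψ => Nat.pair 2 (Nat.pair φ.code ψ.code)
  | or φ ψ => Nat.pair 3 (Nat.pair φ.code ψ.code)
  | imp φ ψ => Nat.pair 4 (Nat.pair φ.code ψ.code)
  | all x φ => Nat.pair 5 (Nat.pair x φ.code)
  | ex x φ => Nat.pair 6 (Nat.pair x φ.code)

/-- Different formulas have different Gödel numbers. -/
theorem code_injective : Function.Injective code := by
  intro φ
  induction φ with
  | bot => intro ψ h; cases ψ <;> simp_all [code, Nat.pair_eq_pair]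
  | atom n i x =>
    intro ψ h
    cases ψ <;> simp only [code, Nat.pair_eq_pair] at h
    case atom m j y =>
      obtain ⟨_, rfl, h⟩ := h
      have h2 := List.ofFn_inj'.mp (Encodable.encode_injective h)
      cases h2
      rfl
    all_goals omega
  | and φ₁ φ₂ ih₁ ih₂ =>
    intro ψ h
    cases ψ <;> simp only [code, Nat.pair_eq_pair] at h
    case and => rw [ih₁ h.2.1, ih₂ h.2.2]
    all_goals omega
  | or φ₁ φ₂ ih₁ ih₂ =>
    intro ψ h
    cases ψ <;> simp only [code, Nat.pair_eq_pair] at h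
    case or => rw [ih₁ h.2.1, ih₂ h.2.2]
    all_goals omega
  | imp φ₁ φ₂ ih₁ ih₂ =>
    intro ψ h
    cases ψ <;> simp only [code, Nat.pair_eq_pair] at h
    case imp => rw [ih₁ h.2.1, ih₂ h.2.2]
    all_goals omega
  | all x φ ih =>
    intro ψ h
    cases ψ <;> simp only [code, Nat.pair_eq_pair] at h
    case all => rw [h.2.1, ih h.2.2]
    all_goals omega
  | ex x φ ih =>
    intro ψ h
    cases ψ <;> simp only [code, Nat.pair_eq_pair] at h
    case ex => rw [h.2.1, ih h.2.2]
    all_goals omega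

end Formula

/-- An intuitionistic predicate Kripke model over the intuitionistic Kripke frame `(W, ≤)`, with
individuals from `D`: non-empty expanding local domains, and an interpretation of the predicate
letters by hereditary relations on the local domains. -/
structure KripkeModel (W : Type) [PartialOrder W] (D : Type) where
  /-- the local domain of a world -/
  dom : W → Set D
  dom_nonempty : ∀ w, (dom w).Nonempty
  dom_mono : ∀ w v, w ≤ v → dom w ⊆ dom v
  /-- `I w n i` interprets the `i`-th `n`-ary predicate letter at the world `w` -/
  I : W → (n : ℕ) → ℕ → Set (Fin n → D)
  I_dom : ∀ w n i a, a ∈ I w n i → ∀ k, a k ∈ dom w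
  I_mono : ∀ w v n i, w ≤ v → I w n i ⊆ I v n i

namespace KripkeModel

variable {W : Type} [PartialOrder W] {D : Type}

/-- Truth of a formula at a world under an assignment. -/
def Forces (M : KripkeModel W D) : W → (ℕ → D) → Formula → Prop
  | _, _, .bot => False
  | w, g, .atom n i x => (fun k => g (x k)) ∈ M.I w n i
  | w, g, .and φ ψ => M.Forces w g φ ∧ M.Forces w g ψ
  | w, g, .or φ ψ => M.Forces w g φ ∨ M.Forces w g ψ
  | w, g, .imp φ ψ => ∀ v, w ≤ v → M.Forces v g φ → M.Forces v g ψ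
  | w, g, .all x φ => ∀ v, w ≤ v → ∀ a ∈ M.dom v, M.Forces v (Function.update g x a) φ
  | w, g, .ex x φ => ∃ a ∈ M.dom w, M.Forces w (Function.update g x a) φ

/-- Truth in a model: truth at every world `w`, under every assignment that sends the free
variables to individuals of `w`. -/
def IsTrue (M : KripkeModel W D) (φ : Formula) : Prop :=
  ∀ (w : W) (g : ℕ → D), (∀ x ∈ φ.freeVars, g x ∈ M.dom w) → M.Forces w g φ

end KripkeModel

/-- Validity on a Kripke frame: truth in every Kripke model (with expanding domains) over it. -/
def FrameValid (W : Type) [PartialOrder W] (φ : Formula) : Prop :=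
  ∀ (D : Type) (M : KripkeModel W D), M.IsTrue φ

/-- The superintuitionistic predicate logic of linear Kripke frames. -/
def QLC : Set Formula :=
  {φ | ∀ (W : Type) [LinearOrder W], FrameValid W φ}

/-- The formulas all of whose variables are among two fixed individual variables. -/
def twoVariable : Set Formula :=
  {φ | φ.vars ⊆ {0, 1}}

/-- The formulas all of whose predicate letters are unary, or equal to one fixed binary letter. -/
def oneBinaryRestUnary : Set Formula :=
  {φ | ∀ p ∈ φ.letters, p.1 = 1 ∨ p = (2, 0)}

/-- A set of formulas is `Σ⁰₁`-complete: its set of Gödel numbers is recursively enumerable, and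
every recursively enumerable set of natural numbers is many-one reducible to it. -/
def SigmaOneComplete (Γ : Set Formula) : Prop :=
  REPred (fun k : ℕ => k ∈ Formula.code '' Γ) ∧
    ∀ p : ℕ → Prop, REPred p → ManyOneReducible p (fun k : ℕ => k ∈ Formula.code '' Γ)

end IntPred

/-!
The two fragments are shown to be recursively enumerable, and then to be `Σ⁰₁`-hard.

*Enumerability.* A formula is refuted in some linear Kripke model if and only if it is refuted in
one whose worlds and individuals are named by natural numbers, where the name of a witness for a
false implication, a false universal formula or a true existential formula is computed from the
world, the formula and the values of its two variables (`NamedModel`, `KripkeModel.toNamed`,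
`NamedModel.not_mem_QLC`). With the names fixed, "this is a refuting model" becomes a computable
set of propositional clauses in countably many variables (`clauses`). By compactness of Cantor
space such a set is unsatisfiable if and only if a finite search shows it
(`not_satisfies_iff_exists_falsified`), so validity is recursively enumerable. That a number is
not the code of a formula of the fragment is also expressed by clauses (`NamedModel.bad`), so no
parsing is needed.

*Hardness.* In a linear model, a unary letter `r` assigns to every individual `a` a truth value,
the set of worlds where `r(a)` holds, and `(r(x) → s(y)) ∧ (s(y) → r(x))` compares two such values
for equality. Two variables are thus enough to speak about elements with many registers, whose
contents come from an infinite set of truth values. Let `G` be a sentence that fails at the root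
and holds everywhere else. Then implications of the form `θ → η ∨ G`, with `θ` and `η` positive
existential formulas over registers, behave classically at the root. Hence universal rules of this
kind entail `G` in `QLC` if and only if they have no classical model in which the goal is empty
(`exists_regStructure_of_not_mem_QLC`, `RegStructure.not_mem_QLC`).

Such rules can evaluate partial recursive functions. Elements stand for numbers, for list cells
and for calls of the codes `Turing.ToPartrec.Code`; each rule copies registers between two
elements or creates one element, following the big-step semantics of codes (`Eval.rules`). In every
model of the rules a call with a value gets done (`Eval.done_of_mem_eval`), and the standard model
of all calls of all codes (`Eval.std`) satisfies the rules without marking a diverging call as done.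
The resulting formulas have only unary letters, so they belong to both fragments.
-/

namespace IntPred

/-! ### Unsatisfiability of computable sets of clauses -/

section Clauses

variable {α ι : Type}

/-- The Boolean valuation `b` makes every clause of the set `C` true. A clause is a list of
literals; the literal `(a, s)` says that the variable `a` has the value `s`. -/
def Satisfies (b : α → Bool) (C : Set (List (α × Bool))) : Prop :=
  ∀ c ∈ C, ∃ l ∈ c, b l.1 = l.2

/-- The bits of `s` below `n` already falsify a clause in one of the first `n` clause lists. -/
def Falsified (cnf : ℕ → List (List (ℕ × Bool))) (n s : ℕ) : Prop :=
  ∃ i < n, ∃ c ∈ cnf i, ∀ l ∈ c, l.1 < n ∧ ¬ (decide (s / 2 ^ l.1 % 2 = 1) = l.2)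

/-- Compactness of Cantor space, in the form of a search: a set of clauses is unsatisfiable if and
only if all bit strings of some length are refuted by inspecting finitely many clauses. -/
theorem not_satisfies_iff_exists_falsified (cnf : ℕ → List (List (ℕ × Bool))) :
    (¬ ∃ b, Satisfies b {c | ∃ i, c ∈ cnf i}) ↔ ∃ n, ∀ s < 2 ^ n, Falsified cnf n s := by
  constructor
  · intro h
    by_contra! hn
    apply h
    -- The valuations that survive stage `n` form a decreasing sequence of nonempty compact sets.
    let K : ℕ → Set (ℕ → Bool) := fun n =>
      {b | ∀ i < n, ∀ c ∈ cnf i, (∀ l ∈ c, l.1 < n) → ∃ l ∈ c, b l.1 = l.2}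
    have hclosed : ∀ n, IsClosed (K n) := by
      intro n
      simp only [K, Set.ofPred_forall]
      refine isClosed_iInter fun i => isClosed_iInter fun _ => isClosed_iInter fun c =>
        isClosed_iInter fun _ => isClosed_iInter fun _ => ?_
      have : {b : ℕ → Bool | ∃ l ∈ c, b l.1 = l.2} =
          ⋃ l ∈ {l | l ∈ c}, {b : ℕ → Bool | b l.1 = l.2} := by
        ext b; simp
      rw [this]
      exact Set.Finite.isClosed_biUnion (List.finite_toSet c) fun l _ =>
        isClosed_eq (continuous_apply _) continuous_const
    have hanti : ∀ n, K (n + 1) ⊆ K n := fun n b hb i hi c hc hl =>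
      hb i (by omega) c hc fun l h => (hl l h).trans (Nat.lt_succ_self n)
    have hne : ∀ n, (K n).Nonempty := by
      intro n
      obtain ⟨s, -, hs⟩ := hn n
      refine ⟨fun a => decide (s / 2 ^ a % 2 = 1), fun i hi c hc hl => ?_⟩
      by_contra! hcon
      exact hs ⟨i, hi, c, hc, fun l h => ⟨hl l h, hcon l h⟩⟩
    obtain ⟨b, hb⟩ := IsCompact.nonempty_iInter_of_sequence_nonempty_isCompact_isClosed K hanti hne
      (hclosed 0).isCompact hclosed
    refine ⟨b, ?_⟩
    rintro c ⟨i, hc⟩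
    obtain ⟨m, hm⟩ : ∃ m, ∀ l ∈ c, l.1 < m := by
      obtain ⟨m, hm⟩ := (c.map Prod.fst).toFinset.exists_nat_subset_range
      exact ⟨m, fun l hl => Finset.mem_range.mp
        (hm (List.mem_toFinset.mpr (List.mem_map_of_mem hl)))⟩
    exact Set.mem_iInter.mp hb (max (i + 1) m) i (by omega) c hc
      fun l hl => (hm l hl).trans_le (le_max_right _ _)
  · rintro ⟨n, hn⟩ ⟨b, hb⟩
    obtain ⟨s, hs, hbit⟩ : ∃ s < 2 ^ n, ∀ a < n, decide (s / 2 ^ a % 2 = 1) = b a := by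
      refine ⟨Nat.ofBits fun i : Fin n => b i, Nat.ofBits_lt_two_pow _, fun a ha => ?_⟩
      rw [← Nat.testBit_eq_decide_div_mod_eq, Nat.testBit_ofBits_lt _ _ ha]
    obtain ⟨i, -, c, hc, hl⟩ := hn s hs
    obtain ⟨l, hlc, h⟩ := hb c ⟨i, hc⟩
    exact (hl l hlc).2 ((hbit _ (hl l hlc).1).trans h)

theorem primrec_two_pow : Primrec fun n : ℕ => 2 ^ n := by
  have : Primrec₂ ((· ^ ·) : ℕ → ℕ → ℕ) := Primrec₂.unpaired'.1 Nat.Primrec.pow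
  exact this.comp (Primrec.const 2) Primrec.id

theorem primrecPred_falsified {cnf : ℕ → ℕ → List (List (ℕ × Bool))} (h : Primrec₂ cnf) :
    PrimrecPred fun q : ℕ × ℕ × ℕ => Falsified (cnf q.1) q.2.1 q.2.2 := by
  have hbit : PrimrecRel fun (l : ℕ × Bool) (ns : ℕ × ℕ) =>
      l.1 < ns.1 ∧ ¬ (decide (ns.2 / 2 ^ l.1 % 2 = 1) = l.2) := by
    refine PrimrecPred.and ?_ (PrimrecPred.not ?_)
    · exact Primrec.nat_lt.comp (Primrec.fst.comp Primrec.fst) (Primrec.fst.comp Primrec.snd)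
    · refine PrimrecRel.comp Primrec.eq ?_ (Primrec.snd.comp Primrec.fst)
      refine PrimrecPred.decide (PrimrecRel.comp Primrec.eq ?_ (Primrec.const 1))
      refine Primrec.nat_mod.comp (Primrec.nat_div.comp (Primrec.snd.comp Primrec.snd) ?_)
        (Primrec.const 2)
      exact primrec_two_pow.comp (Primrec.fst.comp Primrec.fst)
  have hc : PrimrecRel fun (c : List (ℕ × Bool)) (ns : ℕ × ℕ) =>
      ∀ l ∈ c, l.1 < ns.1 ∧ ¬ (decide (ns.2 / 2 ^ l.1 % 2 = 1) = l.2) :=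
    PrimrecRel.forall_mem_list hbit
  have hC := PrimrecRel.exists_mem_list hc
  have hi : PrimrecRel fun (i : ℕ) (q : ℕ × ℕ × ℕ) => ∃ c ∈ cnf q.1 i,
      ∀ l ∈ c, l.1 < q.2.1 ∧ ¬ (decide (q.2.2 / 2 ^ l.1 % 2 = 1) = l.2) :=
    PrimrecRel.comp hC (h.comp (Primrec.fst.comp Primrec.snd) Primrec.fst)
      (Primrec.snd.comp Primrec.snd)
  have h2 := PrimrecRel.exists_mem_list hi
  exact (h2.comp (f := fun q : ℕ × ℕ × ℕ => List.range q.2.1) (g := fun q => q)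
    (Primrec.list_range.comp (Primrec.fst.comp Primrec.snd)) Primrec.id).of_eq
    (by simp [Falsified])

theorem rePred_exists {P : ℕ → ℕ → Prop} (h : PrimrecRel P) : REPred fun k => ∃ n, P k n := by
  classical
  have hd : Computable₂ fun k n => decide (P k n) := (PrimrecPred.decide h).to_comp
  refine (Partrec.rfind hd.partrec₂).dom_re.of_eq fun k => ?_
  refine Nat.rfind_dom.trans ⟨?_, ?_⟩
  · rintro ⟨n, hn, -⟩
    exact ⟨n, by simpa using hn⟩
  · rintro ⟨n, hn⟩
    exact ⟨n, by simpa using hn, fun _ => trivial⟩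

variable [Primcodable α] [Primcodable ι]

/-- The indices `k` for which the `k`-th set of clauses is unsatisfiable form a recursively
enumerable set, provided the clauses are generated by a primitive recursive function. -/
theorem rePred_unsatisfiable {cnf : ℕ → ι → List (List (α × Bool))} (h : Primrec₂ cnf) :
    REPred fun k => ¬ ∃ b, Satisfies b {c | ∃ i, c ∈ cnf k i} := by
  -- Variables and clause indices are replaced by their codes in `ℕ`.
  let lit : α × Bool → ℕ × Bool := fun l => (Encodable.encode l.1, l.2)
  have hlit : Primrec lit := (Primrec.encode.comp Primrec.fst).pair Primrec.snd
  let F : ℕ → ι → List (List (ℕ × Bool)) := fun k i => (cnf k i).map (List.map lit)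
  have hF : Primrec₂ F := Primrec.list_map h
    (Primrec.list_map Primrec.snd (hlit.comp Primrec.snd).to₂).to₂
  let G : ℕ → ℕ → List (List (ℕ × Bool)) := fun k i =>
    Option.casesOn (Encodable.decode (α := ι) i) [] (F k)
  have hG : Primrec₂ G := Primrec.option_casesOn (Primrec.decode.comp Primrec.snd)
    (Primrec.const []) (hF.comp (Primrec.fst.comp Primrec.fst) Primrec.snd).to₂
  have hmem : ∀ k i c, c ∈ cnf k i → c.map lit ∈ G k (Encodable.encode i) := by
    intro k i c hc
    simp only [G, Encodable.encodek, F]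
    exact List.mem_map_of_mem hc
  have hall : PrimrecRel fun k n => ∀ s < 2 ^ n, Falsified (G k) n s := by
    have h1 : PrimrecRel fun (s : ℕ) (q : ℕ × ℕ) => Falsified (G q.1) q.2 s :=
      (primrecPred_falsified hG).comp ((Primrec.fst.comp Primrec.snd).pair
        ((Primrec.snd.comp Primrec.snd).pair Primrec.fst))
    have h2 := PrimrecRel.forall_mem_list h1
    exact (h2.comp (f := fun q : ℕ × ℕ => List.range (2 ^ q.2)) (g := fun q => q)
      (Primrec.list_range.comp (primrec_two_pow.comp Primrec.snd)) Primrec.id).of_eq (by simp)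
  refine (rePred_exists hall).of_eq fun k => ?_
  rw [← not_satisfies_iff_exists_falsified, not_iff_not]
  constructor
  · rintro ⟨b, hb⟩
    refine ⟨fun a => b (Encodable.encode a), ?_⟩
    rintro c ⟨i, hc⟩
    obtain ⟨l, hl, h⟩ := hb _ ⟨_, hmem k i c hc⟩
    obtain ⟨l', hl', rfl⟩ := List.mem_map.mp hl
    exact ⟨l', hl', h⟩
  · rintro ⟨b, hb⟩
    refine ⟨fun n => Option.casesOn (Encodable.decode (α := α) n) false b, ?_⟩
    rintro c ⟨i, hc⟩
    simp only [G] at hc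
    cases hi : (Encodable.decode (α := ι) i) with
    | none => simp [hi] at hc
    | some j =>
      rw [hi] at hc
      obtain ⟨c', hc', rfl⟩ := List.mem_map.mp hc
      obtain ⟨l, hl, h⟩ := hb c' ⟨j, hc'⟩
      exact ⟨lit l, List.mem_map_of_mem hl, by simpa [lit] using h⟩

end Clauses

/-! ### Countermodels with named worlds and individuals -/

section Named

/-- The assignment of `a` to the variable `0` and of `b` to every other variable. -/
def pick {D : Type} (a b : D) (m : ℕ) : D := if m = 0 then a else b

/-- The first component of the pair `(a, b)` of values of the variables `0` and `1`, after the
value of the variable `x` becomes `d`. -/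
def updFst (x a d : ℕ) : ℕ := if x = 0 then d else a

/-- The second component of the pair `(a, b)` of values of the variables `0` and `1`, after the
value of the variable `x` becomes `d`. -/
def updSnd (x b d : ℕ) : ℕ := if x = 0 then b else d

/-- The code of the atom with the `i`-th letter of arity `l.length` and the variables `l`. -/
def atomCode (i : ℕ) (l : List ℕ) : ℕ := Nat.pair 1 (Nat.pair i (Encodable.encode l))

/-- The code of a compound formula with tag `t`; for a quantifier, `φ` is the bound variable. -/
def binCode (t φ ψ : ℕ) : ℕ := Nat.pair t (Nat.pair φ ψ)

/-- The name of a world and of an individual that witness the falsity of an implication or of a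
universal formula, or the truth of an existential formula, with code `ψ`, at the world named `w`
under the assignment of the individuals named `a` and `b`. The names `0` and `1` are reserved for
the root and the initial assignment. -/
def witName (w ψ a b : ℕ) : ℕ := Nat.pair w (Nat.pair ψ (Nat.pair a b)) + 2

/-- A linear Kripke model with worlds and individuals named by natural numbers, together with its
truth relation for the formulas in two variables, given by their codes; it refutes the formula
with code `k` at the world `0`, unless `k` is `bad`. The predicate `ok` selects the admissible
atoms, and `bad` is to hold of the numbers that are not codes of formulas in the variables
`0`, `1` built from admissible atoms. Every field only refers to finitely many truth values, at
places that can be computed from its parameters. -/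
structure NamedModel (ok : ℕ → List ℕ → Bool) (k : ℕ) where
  le : ℕ → ℕ → Prop
  dom : ℕ → ℕ → Prop
  holds : ℕ → ℕ → ℕ → ℕ → Prop
  atom : ℕ → ℕ → List ℕ → Prop
  bad : ℕ → Prop
  le_refl : ∀ w, le w w
  le_trans : ∀ w v u, le w v → le v u → le w u
  le_total : ∀ w v, le w v ∨ le v w
  zero_le : ∀ w, le 0 w
  dom_mono : ∀ w v d, le w v → dom w d → dom v d
  dom_zero : dom 0 0
  dom_one : dom 0 1
  atom_mono : ∀ w v i l, le w v → atom w i l → atom v i l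
  holds_mono : ∀ w v ψ a b, le w v → holds w ψ a b → holds v ψ a b
  not_bad_bot : ¬ bad (Nat.pair 0 0)
  bad_atom : ∀ i l, bad (atomCode i l) ↔ ok i l = false
  bad_and : ∀ φ ψ, bad (binCode 2 φ ψ) → bad φ ∨ bad ψ
  bad_or : ∀ φ ψ, bad (binCode 3 φ ψ) → bad φ ∨ bad ψ
  bad_imp : ∀ φ ψ, bad (binCode 4 φ ψ) → bad φ ∨ bad ψ
  bad_all_zero : ∀ φ, bad (binCode 5 0 φ) → bad φ
  bad_all_one : ∀ φ, bad (binCode 5 1 φ) → bad φ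
  bad_ex_zero : ∀ φ, bad (binCode 6 0 φ) → bad φ
  bad_ex_one : ∀ φ, bad (binCode 6 1 φ) → bad φ
  holds_bot : ∀ w a b, ¬ holds w (Nat.pair 0 0) a b
  holds_atom : ∀ w i l a b, ¬ bad (atomCode i l) →
    (holds w (atomCode i l) a b ↔ atom w i (l.map (pick a b)))
  holds_and : ∀ w φ ψ a b, ¬ bad (binCode 2 φ ψ) →
    (holds w (binCode 2 φ ψ) a b ↔ holds w φ a b ∧ holds w ψ a b)
  holds_or : ∀ w φ ψ a b, ¬ bad (binCode 3 φ ψ) →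
    (holds w (binCode 3 φ ψ) a b ↔ holds w φ a b ∨ holds w ψ a b)
  of_holds_imp : ∀ w v φ ψ a b, ¬ bad (binCode 4 φ ψ) →
    holds w (binCode 4 φ ψ) a b → le w v → holds v φ a b → holds v ψ a b
  of_not_holds_imp : ∀ w φ ψ a b, ¬ bad (binCode 4 φ ψ) → ¬ holds w (binCode 4 φ ψ) a b →
    le w (witName w (binCode 4 φ ψ) a b) ∧ holds (witName w (binCode 4 φ ψ) a b) φ a b ∧
      ¬ holds (witName w (binCode 4 φ ψ) a b) ψ a b
  of_holds_all : ∀ w v x φ a b d, ¬ bad (binCode 5 x φ) → holds w (binCode 5 x φ) a b →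
    le w v → dom v d → holds v φ (updFst x a d) (updSnd x b d)
  of_not_holds_all : ∀ w x φ a b, ¬ bad (binCode 5 x φ) → ¬ holds w (binCode 5 x φ) a b →
    le w (witName w (binCode 5 x φ) a b) ∧
    dom (witName w (binCode 5 x φ) a b) (witName w (binCode 5 x φ) a b) ∧
    ¬ holds (witName w (binCode 5 x φ) a b) φ (updFst x a (witName w (binCode 5 x φ) a b))
      (updSnd x b (witName w (binCode 5 x φ) a b))
  of_holds_ex : ∀ w x φ a b, ¬ bad (binCode 6 x φ) → holds w (binCode 6 x φ) a b →
    dom w (witName w (binCode 6 x φ) a b) ∧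
    holds w φ (updFst x a (witName w (binCode 6 x φ) a b))
      (updSnd x b (witName w (binCode 6 x φ) a b))
  of_not_holds_ex : ∀ w x φ a b d, ¬ bad (binCode 6 x φ) → ¬ holds w (binCode 6 x φ) a b →
    dom w d → ¬ holds w φ (updFst x a d) (updSnd x b d)
  root : bad k ∨ ¬ holds 0 k 0 1

/-! ### Named models as solutions of clauses -/

/-- The propositional variable for `NamedModel.le w v`, a list of natural numbers that starts with a
tag. -/
def leVar (w v : ℕ) : List ℕ := [0, w, v]
/-- The propositional variable for `NamedModel.dom w d`. -/
def domVar (w d : ℕ) : List ℕ := [1, w, d]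
/-- The propositional variable for `NamedModel.holds w ψ a b`. -/
def holdsVar (w ψ a b : ℕ) : List ℕ := [2, w, ψ, a, b]
/-- The propositional variable for `NamedModel.atom w i l`. -/
def atomVar (w i : ℕ) (l : List ℕ) : List ℕ := 3 :: w :: i :: l
/-- The propositional variable for `NamedModel.bad ψ`. -/
def badVar (ψ : ℕ) : List ℕ := [4, ψ]

/-- The positive literal. -/
def yes (a : List ℕ) : List ℕ × Bool := (a, true)
/-- The negative literal. -/
def no (a : List ℕ) : List ℕ × Bool := (a, false)

/-- The parameters of the clauses: two worlds, two formula codes, three individuals, a variable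
and a list of variables or individuals. -/
abbrev ClauseParam : Type := ℕ × ℕ × ℕ × ℕ × ℕ × ℕ × ℕ × ℕ × List ℕ

/-- The fields of `NamedModel` as clauses. -/
def clauses (ok : ℕ → List ℕ → Bool) (k : ℕ) : ClauseParam → List (List (List ℕ × Bool)) :=
  fun (w, v, φ, ψ, a, b, d, x, l) =>
  [ [yes (leVar w w)],
    [no (leVar w v), no (leVar v d), yes (leVar w d)],
    [yes (leVar w v), yes (leVar v w)],
    [yes (leVar 0 w)],
    [no (leVar w v), no (domVar w d), yes (domVar v d)],
    [yes (domVar 0 0)],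
    [yes (domVar 0 1)],
    [no (leVar w v), no (atomVar w φ l), yes (atomVar v φ l)],
    [no (leVar w v), no (holdsVar w ψ a b), yes (holdsVar v ψ a b)],
    [no (badVar (Nat.pair 0 0))],
    [(badVar (atomCode φ l), !ok φ l)],
    [no (badVar (binCode 2 φ ψ)), yes (badVar φ), yes (badVar ψ)],
    [no (badVar (binCode 3 φ ψ)), yes (badVar φ), yes (badVar ψ)],
    [no (badVar (binCode 4 φ ψ)), yes (badVar φ), yes (badVar ψ)],
    [no (badVar (binCode 5 0 φ)), yes (badVar φ)],
    [no (badVar (binCode 5 1 φ)), yes (badVar φ)],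
    [no (badVar (binCode 6 0 φ)), yes (badVar φ)],
    [no (badVar (binCode 6 1 φ)), yes (badVar φ)],
    [no (holdsVar w (Nat.pair 0 0) a b)],
    [yes (badVar (atomCode φ l)), no (holdsVar w (atomCode φ l) a b),
      yes (atomVar w φ (l.map (pick a b)))],
    [yes (badVar (atomCode φ l)), yes (holdsVar w (atomCode φ l) a b),
      no (atomVar w φ (l.map (pick a b)))],
    [yes (badVar (binCode 2 φ ψ)), no (holdsVar w (binCode 2 φ ψ) a b), yes (holdsVar w φ a b)],
    [yes (badVar (binCode 2 φ ψ)), no (holdsVar w (binCode 2 φ ψ) a b), yes (holdsVar w ψ a b)],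
    [yes (badVar (binCode 2 φ ψ)), yes (holdsVar w (binCode 2 φ ψ) a b), no (holdsVar w φ a b),
      no (holdsVar w ψ a b)],
    [yes (badVar (binCode 3 φ ψ)), no (holdsVar w (binCode 3 φ ψ) a b), yes (holdsVar w φ a b),
      yes (holdsVar w ψ a b)],
    [yes (badVar (binCode 3 φ ψ)), yes (holdsVar w (binCode 3 φ ψ) a b), no (holdsVar w φ a b)],
    [yes (badVar (binCode 3 φ ψ)), yes (holdsVar w (binCode 3 φ ψ) a b), no (holdsVar w ψ a b)],
    [yes (badVar (binCode 4 φ ψ)), no (holdsVar w (binCode 4 φ ψ) a b), no (leVar w v),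
      no (holdsVar v φ a b), yes (holdsVar v ψ a b)],
    [yes (badVar (binCode 4 φ ψ)), yes (holdsVar w (binCode 4 φ ψ) a b),
      yes (leVar w (witName w (binCode 4 φ ψ) a b))],
    [yes (badVar (binCode 4 φ ψ)), yes (holdsVar w (binCode 4 φ ψ) a b),
      yes (holdsVar (witName w (binCode 4 φ ψ) a b) φ a b)],
    [yes (badVar (binCode 4 φ ψ)), yes (holdsVar w (binCode 4 φ ψ) a b),
      no (holdsVar (witName w (binCode 4 φ ψ) a b) ψ a b)],
    [yes (badVar (binCode 5 x φ)), no (holdsVar w (binCode 5 x φ) a b), no (leVar w v),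
      no (domVar v d), yes (holdsVar v φ (updFst x a d) (updSnd x b d))],
    [yes (badVar (binCode 5 x φ)), yes (holdsVar w (binCode 5 x φ) a b),
      yes (leVar w (witName w (binCode 5 x φ) a b))],
    [yes (badVar (binCode 5 x φ)), yes (holdsVar w (binCode 5 x φ) a b),
      yes (domVar (witName w (binCode 5 x φ) a b) (witName w (binCode 5 x φ) a b))],
    [yes (badVar (binCode 5 x φ)), yes (holdsVar w (binCode 5 x φ) a b),
      no (holdsVar (witName w (binCode 5 x φ) a b) φ
        (updFst x a (witName w (binCode 5 x φ) a b))
        (updSnd x b (witName w (binCode 5 x φ) a b)))],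
    [yes (badVar (binCode 6 x φ)), no (holdsVar w (binCode 6 x φ) a b),
      yes (domVar w (witName w (binCode 6 x φ) a b))],
    [yes (badVar (binCode 6 x φ)), no (holdsVar w (binCode 6 x φ) a b),
      yes (holdsVar w φ (updFst x a (witName w (binCode 6 x φ) a b))
        (updSnd x b (witName w (binCode 6 x φ) a b)))],
    [yes (badVar (binCode 6 x φ)), yes (holdsVar w (binCode 6 x φ) a b),
      no (domVar w d), no (holdsVar w φ (updFst x a d) (updSnd x b d))],
    [yes (badVar k), no (holdsVar 0 k 0 1)] ]

theorem nonempty_namedModel_of_satisfies {ok : ℕ → List ℕ → Bool} {k : ℕ} {β : List ℕ → Bool}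
    (hβ : Satisfies β {c | ∃ i, c ∈ clauses ok k i}) : Nonempty (NamedModel ok k) := by
  have h (j : ℕ) (p : ClauseParam) (c) (hc : (clauses ok k p)[j]? = some c) :
      ∃ l ∈ c, β l.1 = l.2 := hβ c ⟨p, List.mem_of_getElem? hc⟩
  refine ⟨⟨fun w v => β (leVar w v) = true, fun w d => β (domVar w d) = true,
    fun w ψ a b => β (holdsVar w ψ a b) = true, fun w i l => β (atomVar w i l) = true,
    fun ψ => β (badVar ψ) = true, ?_, ?_, ?_, ?_, ?_, ?_, ?_, ?_, ?_, ?_, ?_, ?_, ?_, ?_, ?_, ?_,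
    ?_, ?_, ?_, ?_, ?_, ?_, ?_, ?_, ?_, ?_, ?_, ?_, ?_⟩⟩
  · exact fun w => by simpa [yes] using h 0 (w, 0, 0, 0, 0, 0, 0, 0, []) _ rfl
  · intro w v u
    have := h 1 (w, v, 0, 0, 0, 0, u, 0, []) _ rfl
    simp [yes, no] at this; grind
  · exact fun w v => by simpa [yes] using h 2 (w, v, 0, 0, 0, 0, 0, 0, []) _ rfl
  · exact fun w => by simpa [yes] using h 3 (w, 0, 0, 0, 0, 0, 0, 0, []) _ rfl
  · intro w v d
    have := h 4 (w, v, 0, 0, 0, 0, d, 0, []) _ rfl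
    simp [yes, no] at this; grind
  · simpa [yes] using h 5 (0, 0, 0, 0, 0, 0, 0, 0, []) _ rfl
  · simpa [yes] using h 6 (0, 0, 0, 0, 0, 0, 0, 0, []) _ rfl
  · intro w v i l
    have := h 7 (w, v, i, 0, 0, 0, 0, 0, l) _ rfl
    simp [yes, no] at this; grind
  · intro w v ψ a b
    have := h 8 (w, v, 0, ψ, a, b, 0, 0, []) _ rfl
    simp [yes, no] at this; grind
  · simpa [no] using h 9 (0, 0, 0, 0, 0, 0, 0, 0, []) _ rfl
  · intro i l
    have := h 10 (0, 0, i, 0, 0, 0, 0, 0, l) _ rfl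
    simp at this; simp [this]
  · intro φ ψ
    have := h 11 (0, 0, φ, ψ, 0, 0, 0, 0, []) _ rfl
    simp [yes, no] at this; grind
  · intro φ ψ
    have := h 12 (0, 0, φ, ψ, 0, 0, 0, 0, []) _ rfl
    simp [yes, no] at this; grind
  · intro φ ψ
    have := h 13 (0, 0, φ, ψ, 0, 0, 0, 0, []) _ rfl
    simp [yes, no] at this; grind
  · intro φ
    have := h 14 (0, 0, φ, 0, 0, 0, 0, 0, []) _ rfl
    simp [yes, no] at this; grind
  · intro φ
    have := h 15 (0, 0, φ, 0, 0, 0, 0, 0, []) _ rfl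
    simp [yes, no] at this; grind
  · intro φ
    have := h 16 (0, 0, φ, 0, 0, 0, 0, 0, []) _ rfl
    simp [yes, no] at this; grind
  · intro φ
    have := h 17 (0, 0, φ, 0, 0, 0, 0, 0, []) _ rfl
    simp [yes, no] at this; grind
  · intro w a b
    simpa [no] using h 18 (w, 0, 0, 0, a, b, 0, 0, []) _ rfl
  · intro w i l a b
    have h1 := h 19 (w, 0, i, 0, a, b, 0, 0, l) _ rfl
    have h2 := h 20 (w, 0, i, 0, a, b, 0, 0, l) _ rfl
    simp [yes, no] at h1 h2; grind
  · intro w φ ψ a b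
    have h1 := h 21 (w, 0, φ, ψ, a, b, 0, 0, []) _ rfl
    have h2 := h 22 (w, 0, φ, ψ, a, b, 0, 0, []) _ rfl
    have h3 := h 23 (w, 0, φ, ψ, a, b, 0, 0, []) _ rfl
    simp [yes, no] at h1 h2 h3; grind
  · intro w φ ψ a b
    have h1 := h 24 (w, 0, φ, ψ, a, b, 0, 0, []) _ rfl
    have h2 := h 25 (w, 0, φ, ψ, a, b, 0, 0, []) _ rfl
    have h3 := h 26 (w, 0, φ, ψ, a, b, 0, 0, []) _ rfl
    simp [yes, no] at h1 h2 h3; grind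
  · intro w v φ ψ a b
    have h1 := h 27 (w, v, φ, ψ, a, b, 0, 0, []) _ rfl
    simp [yes, no] at h1; grind
  · intro w φ ψ a b
    have h1 := h 28 (w, 0, φ, ψ, a, b, 0, 0, []) _ rfl
    have h2 := h 29 (w, 0, φ, ψ, a, b, 0, 0, []) _ rfl
    have h3 := h 30 (w, 0, φ, ψ, a, b, 0, 0, []) _ rfl
    simp [yes, no] at h1 h2 h3; grind
  · intro w v x φ a b d
    have h1 := h 31 (w, v, φ, 0, a, b, d, x, []) _ rfl
    simp [yes, no] at h1; grind
  · intro w x φ a b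
    have h1 := h 32 (w, 0, φ, 0, a, b, 0, x, []) _ rfl
    have h2 := h 33 (w, 0, φ, 0, a, b, 0, x, []) _ rfl
    have h3 := h 34 (w, 0, φ, 0, a, b, 0, x, []) _ rfl
    simp [yes, no] at h1 h2 h3; grind
  · intro w x φ a b
    have h1 := h 35 (w, 0, φ, 0, a, b, 0, x, []) _ rfl
    have h2 := h 36 (w, 0, φ, 0, a, b, 0, x, []) _ rfl
    simp [yes, no] at h1 h2; grind
  · intro w x φ a b d
    have h1 := h 37 (w, 0, φ, 0, a, b, d, x, []) _ rfl
    simp [yes, no] at h1; grind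
  · simpa [yes, no] using h 38 (0, 0, 0, 0, 0, 0, 0, 0, []) _ rfl

open Classical in
/-- The truth values of the propositional variables in a named model. -/
noncomputable def NamedModel.val {ok : ℕ → List ℕ → Bool} {k : ℕ} (N : NamedModel ok k) :
    List ℕ → Bool
  | [0, w, v] => decide (N.le w v)
  | [1, w, d] => decide (N.dom w d)
  | [2, w, ψ, a, b] => decide (N.holds w ψ a b)
  | 3 :: w :: i :: l => decide (N.atom w i l)
  | [4, ψ] => decide (N.bad ψ)
  | _ => false

theorem NamedModel.satisfies_val {ok : ℕ → List ℕ → Bool} {k : ℕ} (N : NamedModel ok k) :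
    Satisfies N.val {c | ∃ i, c ∈ clauses ok k i} := by
  classical
  have h0 : ∀ w v, N.val (leVar w v) = decide (N.le w v) := fun _ _ => rfl
  have h1 : ∀ w v, N.val (domVar w v) = decide (N.dom w v) := fun _ _ => rfl
  have h2 : ∀ w ψ a b, N.val (holdsVar w ψ a b) = decide (N.holds w ψ a b) := fun _ _ _ _ => rfl
  have h3 : ∀ w i l, N.val (atomVar w i l) = decide (N.atom w i l) := fun _ _ _ => rfl
  have h4 : ∀ ψ, N.val (badVar ψ) = decide (N.bad ψ) := fun _ => rfl
  rintro c ⟨⟨w, v, φ, ψ, a, b, d, x, l⟩, hc⟩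
  revert c
  simp only [clauses, List.forall_mem_cons, List.exists_mem_cons_iff, yes, no, h0, h1, h2, h3, h4,
    decide_eq_true_eq, decide_eq_false_iff_not, List.not_mem_nil, false_and, exists_false,
    or_false, IsEmpty.forall_iff, implies_true, and_true]
  refine ⟨?_, ?_, ?_, ?_, ?_, ?_, ?_, ?_, ?_, ?_, ?_, ?_, ?_, ?_, ?_, ?_, ?_, ?_, ?_, ?_, ?_,
    ?_, ?_, ?_, ?_, ?_, ?_, ?_, ?_, ?_, ?_, ?_, ?_, ?_, ?_, ?_, ?_, ?_, ?_⟩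
  · exact N.le_refl w
  · have := N.le_trans w v d; tauto
  · exact N.le_total w v
  · exact N.zero_le w
  · have := N.dom_mono w v d; tauto
  · exact N.dom_zero
  · exact N.dom_one
  · have := N.atom_mono w v φ l; tauto
  · have := N.holds_mono w v ψ a b; tauto
  · exact N.not_bad_bot
  · cases h : ok φ l <;> simp [N.bad_atom, h]
  · have := N.bad_and φ ψ; tauto
  · have := N.bad_or φ ψ; tauto
  · have := N.bad_imp φ ψ; tauto
  · have := N.bad_all_zero φ; tauto
  · have := N.bad_all_one φ; tauto
  · have := N.bad_ex_zero φ; tauto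
  · have := N.bad_ex_one φ; tauto
  · have := N.holds_bot w a b; tauto
  · have := N.holds_atom w φ l a b; tauto
  · have := N.holds_atom w φ l a b; tauto
  · have := N.holds_and w φ ψ a b; tauto
  · have := N.holds_and w φ ψ a b; tauto
  · have := N.holds_and w φ ψ a b; tauto
  · have := N.holds_or w φ ψ a b; tauto
  · have := N.holds_or w φ ψ a b; tauto
  · have := N.holds_or w φ ψ a b; tauto
  · have := N.of_holds_imp w v φ ψ a b; tauto
  · have := N.of_not_holds_imp w φ ψ a b; tauto
  · have := N.of_not_holds_imp w φ ψ a b; tauto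
  · have := N.of_not_holds_imp w φ ψ a b; tauto
  · have := N.of_holds_all w v x φ a b d; tauto
  · have := N.of_not_holds_all w x φ a b; tauto
  · have := N.of_not_holds_all w x φ a b; tauto
  · have := N.of_not_holds_all w x φ a b; tauto
  · have := N.of_holds_ex w x φ a b; tauto
  · have := N.of_holds_ex w x φ a b; tauto
  · have := N.of_not_holds_ex w x φ a b d; tauto
  · exact N.root

end Named

/-! ### Computability of the clauses -/

section PrimrecClauses

variable {α : Type} [Primcodable α] {f g h i : α → ℕ} {l : α → List ℕ}

theorem primrec_cons {β : Type} [Primcodable β] {f : α → β} {l : α → List β} (hf : Primrec f)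
    (hl : Primrec l) : Primrec fun x => f x :: l x :=
  Primrec.list_cons.comp hf hl

theorem primrec_natPair (hf : Primrec f) (hg : Primrec g) :
    Primrec fun x => Nat.pair (f x) (g x) :=
  Primrec₂.natPair.comp hf hg

theorem primrec_atomCode (hf : Primrec f) (hl : Primrec l) :
    Primrec fun x => atomCode (f x) (l x) :=
  primrec_natPair (.const 1) (primrec_natPair hf (Primrec.encode.comp hl))

theorem primrec_binCode (hf : Primrec f) (hg : Primrec g) (hh : Primrec h) :
    Primrec fun x => binCode (f x) (g x) (h x) :=
  primrec_natPair hf (primrec_natPair hg hh)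

theorem primrec_witName (hf : Primrec f) (hg : Primrec g) (hh : Primrec h) (hi : Primrec i) :
    Primrec fun x => witName (f x) (g x) (h x) (i x) :=
  Primrec.nat_add.comp (primrec_natPair hf (primrec_natPair hg (primrec_natPair hh hi))) (.const 2)

theorem primrec_updFst (hf : Primrec f) (hg : Primrec g) (hh : Primrec h) :
    Primrec fun x => updFst (f x) (g x) (h x) :=
  Primrec.ite (PrimrecRel.comp Primrec.eq hf (.const 0)) hh hg

theorem primrec_updSnd (hf : Primrec f) (hg : Primrec g) (hh : Primrec h) :
    Primrec fun x => updSnd (f x) (g x) (h x) :=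
  Primrec.ite (PrimrecRel.comp Primrec.eq hf (.const 0)) hg hh

theorem primrec_map_pick (hl : Primrec l) (hf : Primrec f) (hg : Primrec g) :
    Primrec fun x => (l x).map (pick (f x) (g x)) :=
  Primrec.list_map hl (Primrec.ite (PrimrecRel.comp Primrec.eq Primrec.snd (.const 0))
    (hf.comp Primrec.fst) (hg.comp Primrec.fst)).to₂

theorem primrec_leVar (hf : Primrec f) (hg : Primrec g) : Primrec fun x => leVar (f x) (g x) :=
  primrec_cons (.const 0) (primrec_cons hf (primrec_cons hg (.const [])))

theorem primrec_domVar (hf : Primrec f) (hg : Primrec g) : Primrec fun x => domVar (f x) (g x) :=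
  primrec_cons (.const 1) (primrec_cons hf (primrec_cons hg (.const [])))

theorem primrec_holdsVar (hf : Primrec f) (hg : Primrec g) (hh : Primrec h) (hi : Primrec i) :
    Primrec fun x => holdsVar (f x) (g x) (h x) (i x) :=
  primrec_cons (.const 2) (primrec_cons hf (primrec_cons hg (primrec_cons hh
    (primrec_cons hi (.const [])))))

theorem primrec_atomVar (hf : Primrec f) (hg : Primrec g) (hl : Primrec l) :
    Primrec fun x => atomVar (f x) (g x) (l x) :=
  primrec_cons (.const 3) (primrec_cons hf (primrec_cons hg hl))

theorem primrec_badVar (hf : Primrec f) : Primrec fun x => badVar (f x) :=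
  primrec_cons (.const 4) (primrec_cons hf (.const []))

theorem primrec_yes (hl : Primrec l) : Primrec fun x => yes (l x) := hl.pair (.const true)

theorem primrec_no (hl : Primrec l) : Primrec fun x => no (l x) := hl.pair (.const false)

theorem primrec_clauses {ok : ℕ → List ℕ → Bool} (hok : Primrec₂ ok) :
    Primrec₂ (clauses ok) := by
  have key : ∀ {k w v φ ψ a b d y : ℕ × ClauseParam → ℕ} {l : ℕ × ClauseParam → List ℕ},
      Primrec k → Primrec w → Primrec v → Primrec φ → Primrec ψ → Primrec a → Primrec b →
      Primrec d → Primrec y → Primrec l → Primrec fun q =>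
        clauses ok (k q) (w q, v q, φ q, ψ q, a q, b q, d q, y q, l q) := by
    intro k w v φ ψ a b d y l hk hw hv hφ hψ ha hb hd hy hl
    simp only [clauses]
    have : Primrec fun q => !ok (φ q) (l q) := Primrec.not.comp (hok.comp hφ hl)
    repeat' first
      | with_reducible assumption
      | with_reducible exact Primrec.const _
      | with_reducible apply primrec_cons
      | with_reducible apply primrec_yes
      | with_reducible apply primrec_no
      | with_reducible apply primrec_leVar
      | with_reducible apply primrec_domVar
      | with_reducible apply primrec_holdsVar
      | with_reducible apply primrec_atomVar
      | with_reducible apply primrec_badVar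
      | with_reducible apply primrec_map_pick
      | with_reducible apply primrec_updFst
      | with_reducible apply primrec_updSnd
      | with_reducible apply primrec_witName
      | with_reducible apply primrec_binCode
      | with_reducible apply primrec_atomCode
      | with_reducible apply Primrec.pair
  have h2 := @Primrec.snd ℕ ClauseParam _ _
  have p1 := Primrec.snd.comp h2
  have p2 := Primrec.snd.comp p1
  have p3 := Primrec.snd.comp p2
  have p4 := Primrec.snd.comp p3
  have p5 := Primrec.snd.comp p4
  have p6 := Primrec.snd.comp p5
  have p7 := Primrec.snd.comp p6
  exact (key Primrec.fst (Primrec.fst.comp h2) (Primrec.fst.comp p1) (Primrec.fst.comp p2)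
    (Primrec.fst.comp p3) (Primrec.fst.comp p4) (Primrec.fst.comp p5) (Primrec.fst.comp p6)
    (Primrec.fst.comp p7) (Primrec.snd.comp p7)).of_eq fun _ => rfl

theorem rePred_isEmpty_namedModel {ok : ℕ → List ℕ → Bool} (hok : Primrec₂ ok) :
    REPred fun k => IsEmpty (NamedModel ok k) :=
  (rePred_unsatisfiable (primrec_clauses hok)).of_eq fun k => by
    rw [← not_nonempty_iff, not_iff_not]
    exact ⟨fun ⟨_, hb⟩ => nonempty_namedModel_of_satisfies hb, fun ⟨N⟩ => ⟨N.val, N.satisfies_val⟩⟩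

end PrimrecClauses

/-! ### From named models to Kripke models -/

/-- The formulas in the variables `0` and `1` all of whose atoms are admissible; an atom is given
to `ok` by the number of its letter and the list of its variables. -/
def Formula.Good (ok : ℕ → List ℕ → Bool) : Formula → Prop
  | bot => True
  | atom _ i x => ok i (List.ofFn x) = true
  | and φ ψ => φ.Good ok ∧ ψ.Good ok
  | or φ ψ => φ.Good ok ∧ ψ.Good ok
  | imp φ ψ => φ.Good ok ∧ ψ.Good ok
  | all x φ => x < 2 ∧ φ.Good ok
  | ex x φ => x < 2 ∧ φ.Good ok

theorem updFst_eq_update {g : ℕ → ℕ} {x d : ℕ} : updFst x (g 0) d = Function.update g x d 0 := by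
  by_cases h : x = 0
  · subst h; simp [updFst]
  · simp [updFst, h, Function.update_of_ne (Ne.symm h)]

theorem updSnd_eq_update {g : ℕ → ℕ} {x d : ℕ} (hx : x < 2) :
    updSnd x (g 1) d = Function.update g x d 1 := by
  obtain rfl | rfl : x = 0 ∨ x = 1 := by omega
  · simp [updSnd]
  · simp [updSnd]

namespace NamedModel

variable {ok : ℕ → List ℕ → Bool} {k : ℕ} (N : NamedModel ok k)

theorem not_bad_code {φ : Formula} (hφ : φ.Good ok) : ¬ N.bad φ.code := by
  induction φ with
  | bot => exact N.not_bad_bot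
  | atom n i x => exact fun h => by simp_all [Formula.Good, (N.bad_atom _ _).mp h]
  | and φ ψ h1 h2 => exact fun h => (N.bad_and _ _ h).elim (h1 hφ.1) (h2 hφ.2)
  | or φ ψ h1 h2 => exact fun h => (N.bad_or _ _ h).elim (h1 hφ.1) (h2 hφ.2)
  | imp φ ψ h1 h2 => exact fun h => (N.bad_imp _ _ h).elim (h1 hφ.1) (h2 hφ.2)
  | all x φ h1 =>
    obtain ⟨hx, hφ⟩ := hφ
    obtain rfl | rfl : x = 0 ∨ x = 1 := by omega
    · exact fun h => h1 hφ (N.bad_all_zero _ h)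
    · exact fun h => h1 hφ (N.bad_all_one _ h)
  | ex x φ h1 =>
    obtain ⟨hx, hφ⟩ := hφ
    obtain rfl | rfl : x = 0 ∨ x = 1 := by omega
    · exact fun h => h1 hφ (N.bad_ex_zero _ h)
    · exact fun h => h1 hφ (N.bad_ex_one _ h)

/-- The worlds of a named model. Equivalent names of worlds are not identified, but ordered by
their size, so that the preorder `le` becomes a linear order. -/
structure World (N : NamedModel ok k) where
  name : ℕ

open Classical in
noncomputable instance : LinearOrder N.World where
  le w v := N.le w.name v.name ∧ (N.le v.name w.name → w.name ≤ v.name)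
  le_refl w := ⟨N.le_refl _, fun _ => le_rfl⟩
  le_trans w v u h1 h2 := ⟨N.le_trans _ _ _ h1.1 h2.1, fun h =>
    (h1.2 (N.le_trans _ _ _ h2.1 h)).trans (h2.2 (N.le_trans _ _ _ h h1.1))⟩
  le_antisymm := by
    rintro ⟨w⟩ ⟨v⟩ h1 h2
    exact congrArg _ (le_antisymm (h1.2 h2.1) (h2.2 h1.1))
  le_total w v := by
    rcases N.le_total w.name v.name with h | h <;>
      rcases _root_.le_total w.name v.name with h' | h' <;> tauto
  toDecidableLE := fun _ _ => propDecidable _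

/-- Every name above `w` is equivalent to one above `w` in the linear order of worlds. -/
theorem exists_world_ge {w : N.World} {s : ℕ} (h : N.le w.name s) :
    ∃ v : N.World, w ≤ v ∧ N.le v.name s ∧ N.le s v.name := by
  by_cases hs : N.le s w.name
  · exact ⟨w, le_rfl, h, hs⟩
  · exact ⟨⟨s⟩, ⟨h, fun h' => absurd h' hs⟩, N.le_refl _, N.le_refl _⟩

/-- The Kripke model described by a named model. -/
def toKripke : KripkeModel N.World ℕ where
  dom w := {d | N.dom w.name d}
  dom_nonempty _ := ⟨0, N.dom_mono _ _ _ (N.zero_le _) N.dom_zero⟩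
  dom_mono _ _ h _ hd := N.dom_mono _ _ _ h.1 hd
  I w _ i := {t | N.atom w.name i (List.ofFn t) ∧ ∀ j, N.dom w.name (t j)}
  I_dom _ _ _ _ ha j := ha.2 j
  I_mono _ _ _ _ h _ ha :=
    ⟨N.atom_mono _ _ _ _ h.1 ha.1, fun j => N.dom_mono _ _ _ h.1 (ha.2 j)⟩

/-- The truth lemma. -/
theorem forces_iff_holds (hok : ∀ i l, ok i l = true → ∀ m ∈ l, m < 2) {φ : Formula}
    (hφ : φ.Good ok) (w : N.World) (g : ℕ → ℕ) (h0 : N.dom w.name (g 0))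
    (h1 : N.dom w.name (g 1)) :
    N.toKripke.Forces w g φ ↔ N.holds w.name φ.code (g 0) (g 1) := by
  have hbad := N.not_bad_code hφ
  have hupd : ∀ (v : N.World) (g : ℕ → ℕ) (x d : ℕ), N.dom v.name (g 0) → N.dom v.name (g 1) →
      N.dom v.name d → N.dom v.name (Function.update g x d 0) ∧
        N.dom v.name (Function.update g x d 1) := by
    intro v g x d h0 h1 hd
    simp only [Function.update_apply]
    constructor <;> split_ifs <;> assumption
  induction φ generalizing w g with
  | bot => exact iff_of_false id (N.holds_bot _ _ _)
  | atom n i x =>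
    have hlt : ∀ j, x j < 2 := fun j => hok i _ hφ _ (List.mem_ofFn.mpr ⟨j, rfl⟩)
    have hdom : ∀ j, N.dom w.name (g (x j)) := by
      intro j
      obtain h | h : x j = 0 ∨ x j = 1 := by have := hlt j; omega
      · rwa [h]
      · rwa [h]
    have hl : (List.ofFn x).map (pick (g 0) (g 1)) = List.ofFn fun j => g (x j) := by
      rw [List.map_ofFn]
      congr 1
      funext j
      obtain h | h : x j = 0 ∨ x j = 1 := by have := hlt j; omega
      · simp [pick, h]
      · simp [pick, h]
    refine Iff.trans ?_ (N.holds_atom w.name i (List.ofFn x) (g 0) (g 1) hbad).symm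
    rw [hl]
    exact ⟨fun h => h.1, fun h => ⟨h, hdom⟩⟩
  | and φ ψ ih1 ih2 =>
    refine Iff.trans ?_ (N.holds_and w.name φ.code ψ.code _ _ hbad).symm
    exact and_congr (ih1 hφ.1 w g h0 h1 (N.not_bad_code hφ.1))
      (ih2 hφ.2 w g h0 h1 (N.not_bad_code hφ.2))
  | or φ ψ ih1 ih2 =>
    refine Iff.trans ?_ (N.holds_or w.name φ.code ψ.code _ _ hbad).symm
    exact or_congr (ih1 hφ.1 w g h0 h1 (N.not_bad_code hφ.1))
      (ih2 hφ.2 w g h0 h1 (N.not_bad_code hφ.2))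
  | imp φ ψ ih1 ih2 =>
    have e1 := fun v h0 h1 => ih1 hφ.1 v g h0 h1 (N.not_bad_code hφ.1)
    have e2 := fun v h0 h1 => ih2 hφ.2 v g h0 h1 (N.not_bad_code hφ.2)
    constructor
    · intro h
      by_contra hn
      obtain ⟨hle, hs1, hs2⟩ := N.of_not_holds_imp _ _ _ _ _ hbad hn
      obtain ⟨v, hwv, hvs, hsv⟩ := N.exists_world_ge hle
      have d0 := N.dom_mono _ _ _ hwv.1 h0
      have d1 := N.dom_mono _ _ _ hwv.1 h1
      exact hs2 (N.holds_mono _ _ _ _ _ hvs ((e2 v d0 d1).mp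
        (h v hwv ((e1 v d0 d1).mpr (N.holds_mono _ _ _ _ _ hsv hs1)))))
    · intro h v hwv hv
      have d0 := N.dom_mono _ _ _ hwv.1 h0
      have d1 := N.dom_mono _ _ _ hwv.1 h1
      exact (e2 v d0 d1).mpr (N.of_holds_imp _ _ _ _ _ _ hbad h hwv.1 ((e1 v d0 d1).mp hv))
  | all x φ ih =>
    obtain ⟨hx, hφ⟩ := hφ
    have e : ∀ (v : N.World) (d : ℕ), w ≤ v → N.dom v.name d →
        (N.toKripke.Forces v (Function.update g x d) φ ↔
          N.holds v.name φ.code (updFst x (g 0) d) (updSnd x (g 1) d)) := by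
      intro v d hwv hd
      obtain ⟨d0, d1⟩ := hupd v g x d (N.dom_mono _ _ _ hwv.1 h0) (N.dom_mono _ _ _ hwv.1 h1) hd
      rw [updFst_eq_update, updSnd_eq_update hx]
      exact ih hφ v _ d0 d1 (N.not_bad_code hφ)
    constructor
    · intro h
      by_contra hn
      obtain ⟨hle, hs1, hs2⟩ := N.of_not_holds_all _ _ _ _ _ hbad hn
      obtain ⟨v, hwv, hvs, hsv⟩ := N.exists_world_ge hle
      have hd := N.dom_mono _ _ _ hsv hs1
      exact hs2 (N.holds_mono _ _ _ _ _ hvs ((e v _ hwv hd).mp (h v hwv _ hd)))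
    · intro h v hwv d hd
      exact (e v d hwv hd).mpr (N.of_holds_all _ _ _ _ _ _ _ hbad h hwv.1 hd)
  | ex x φ ih =>
    obtain ⟨hx, hφ⟩ := hφ
    have e : ∀ d : ℕ, N.dom w.name d → (N.toKripke.Forces w (Function.update g x d) φ ↔
          N.holds w.name φ.code (updFst x (g 0) d) (updSnd x (g 1) d)) := by
      intro d hd
      obtain ⟨d0, d1⟩ := hupd w g x d h0 h1 hd
      rw [updFst_eq_update, updSnd_eq_update hx]
      exact ih hφ w _ d0 d1 (N.not_bad_code hφ)
    constructor
    · rintro ⟨d, hd, h⟩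
      by_contra hn
      exact N.of_not_holds_ex _ _ _ _ _ _ hbad hn hd ((e d hd).mp h)
    · intro h
      obtain ⟨hd, hs⟩ := N.of_holds_ex _ _ _ _ _ hbad h
      exact ⟨_, hd, (e _ hd).mpr hs⟩

theorem not_mem_QLC (N : NamedModel ok k) (hok : ∀ i l, ok i l = true → ∀ m ∈ l, m < 2)
    {φ : Formula} (hφ : φ.Good ok) (hk : φ.code = k) : φ ∉ QLC := by
  intro h
  have h0 : ∀ m, N.dom 0 (pick 0 1 m) := by
    intro m
    unfold pick
    split_ifs
    exacts [N.dom_zero, N.dom_one]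
  have := h N.World ℕ N.toKripke ⟨0⟩ (pick 0 1) fun m _ => h0 m
  rw [N.forces_iff_holds hok hφ _ _ (h0 0) (h0 1), hk] at this
  exact (N.root.resolve_left (hk ▸ N.not_bad_code hφ)) this

end NamedModel

/-! ### From Kripke models to named models -/

namespace KripkeModel

variable {W D : Type} [PartialOrder W] (M : KripkeModel W D)

theorem forces_mono {φ : Formula} {w v : W} {g : ℕ → D} (h : w ≤ v) (hw : M.Forces w g φ) :
    M.Forces v g φ := by
  induction φ generalizing g with
  | bot => exact hw
  | atom n i x => exact M.I_mono _ _ _ _ h hw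
  | and φ ψ h1 h2 => exact ⟨h1 hw.1, h2 hw.2⟩
  | or φ ψ h1 h2 => exact hw.imp h1 h2
  | imp φ ψ => exact fun u hu => hw u (h.trans hu)
  | all x φ => exact fun u hu => hw u (h.trans hu)
  | ex x φ ih =>
    obtain ⟨a, ha, hw⟩ := hw
    exact ⟨a, M.dom_mono _ _ h ha, ih hw⟩

theorem forces_congr {φ : Formula} {w : W} {g g' : ℕ → D} (h : ∀ m ∈ φ.freeVars, g m = g' m) :
    M.Forces w g φ ↔ M.Forces w g' φ := by
  induction φ generalizing w g g' with
  | bot => exact Iff.rfl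
  | atom n i x =>
    have : (fun k => g (x k)) = fun k => g' (x k) :=
      funext fun k => h _ (Finset.mem_image_of_mem _ (Finset.mem_univ _))
    simp only [Forces, this]
  | and φ ψ h1 h2 =>
    exact and_congr (h1 fun m hm => h m (Finset.mem_union_left _ hm))
      (h2 fun m hm => h m (Finset.mem_union_right _ hm))
  | or φ ψ h1 h2 =>
    exact or_congr (h1 fun m hm => h m (Finset.mem_union_left _ hm))
      (h2 fun m hm => h m (Finset.mem_union_right _ hm))
  | imp φ ψ h1 h2 =>
    exact forall₂_congr fun v _ => imp_congr (h1 fun m hm => h m (Finset.mem_union_left _ hm))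
      (h2 fun m hm => h m (Finset.mem_union_right _ hm))
  | all x φ ih =>
    refine forall₂_congr fun v _ => forall₂_congr fun a _ => ih fun m hm => ?_
    by_cases hx : m = x
    · subst hx; simp
    · simpa [hx] using h m (Finset.mem_erase.mpr ⟨hx, hm⟩)
  | ex x φ ih =>
    refine exists_congr fun a => and_congr_right fun _ => ih fun m hm => ?_
    by_cases hx : m = x
    · subst hx; simp
    · simpa [hx] using h m (Finset.mem_erase.mpr ⟨hx, hm⟩)

end KripkeModel

theorem Formula.Good.lt_two {ok : ℕ → List ℕ → Bool}
    (hok : ∀ i l, ok i l = true → ∀ m ∈ l, m < 2) {φ : Formula} (hφ : φ.Good ok) :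
    ∀ m ∈ φ.freeVars, m < 2 := by
  induction φ with
  | bot => simp [freeVars]
  | atom n i x =>
    intro m hm
    obtain ⟨j, -, rfl⟩ := Finset.mem_image.mp hm
    exact hok i _ hφ _ (List.mem_ofFn.mpr ⟨j, rfl⟩)
  | and φ ψ h1 h2 => exact fun m hm => (Finset.mem_union.mp hm).elim (h1 hφ.1 m) (h2 hφ.2 m)
  | or φ ψ h1 h2 => exact fun m hm => (Finset.mem_union.mp hm).elim (h1 hφ.1 m) (h2 hφ.2 m)
  | imp φ ψ h1 h2 => exact fun m hm => (Finset.mem_union.mp hm).elim (h1 hφ.1 m) (h2 hφ.2 m)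
  | all x φ ih => exact fun m hm => ih hφ.2 m (Finset.mem_of_mem_erase hm)
  | ex x φ ih => exact fun m hm => ih hφ.2 m (Finset.mem_of_mem_erase hm)

namespace KripkeModel

variable {W D : Type} [PartialOrder W] (M : KripkeModel W D)

/-- The world `p.1` and the individual `p.2` witness the falsity of an implication or of a
universal formula, or the truth of an existential formula, at the world `w`. -/
def Witness (w : W) (g : ℕ → D) : Formula → W × D → Prop
  | .imp φ ψ, p => ¬ M.Forces w g (.imp φ ψ) → M.Forces p.1 g φ ∧ ¬ M.Forces p.1 g ψ
  | .all x φ, p => ¬ M.Forces w g (.all x φ) →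
      p.2 ∈ M.dom p.1 ∧ ¬ M.Forces p.1 (Function.update g x p.2) φ
  | .ex x φ, p => M.Forces w g (.ex x φ) →
      p.2 ∈ M.dom w ∧ M.Forces w (Function.update g x p.2) φ
  | _, _ => True

theorem exists_witness (w : W) (g : ℕ → D) (φ : Formula) :
    ∃ p : W × D, w ≤ p.1 ∧ M.Witness w g φ p := by
  cases φ with
  | bot => exact ⟨(w, g 0), le_rfl, trivial⟩
  | atom => exact ⟨(w, g 0), le_rfl, trivial⟩
  | and => exact ⟨(w, g 0), le_rfl, trivial⟩
  | or => exact ⟨(w, g 0), le_rfl, trivial⟩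
  | imp φ ψ =>
    by_cases h : M.Forces w g (.imp φ ψ)
    · exact ⟨(w, g 0), le_rfl, fun h' => absurd h h'⟩
    · have h' := h
      simp only [Forces, not_forall] at h'
      obtain ⟨v, hv, h1, h2⟩ := h'
      exact ⟨(v, g 0), hv, fun _ => ⟨h1, h2⟩⟩
  | all x φ =>
    by_cases h : M.Forces w g (.all x φ)
    · exact ⟨(w, g 0), le_rfl, fun h' => absurd h h'⟩
    · have h' := h
      simp only [Forces, not_forall] at h'
      obtain ⟨v, hv, a, h1, h2⟩ := h'
      exact ⟨(v, a), hv, fun _ => ⟨h1, h2⟩⟩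
  | ex x φ =>
    by_cases h : M.Forces w g (.ex x φ)
    · have h' := h
      obtain ⟨a, h1, h2⟩ := h'
      exact ⟨(w, a), le_rfl, fun _ => ⟨h1, h2⟩⟩
    · exact ⟨(w, g 0), le_rfl, fun h' => absurd h' h⟩

end KripkeModel

/-- The formula with a given code. -/
noncomputable def Formula.ofCode : ℕ → Formula :=
  haveI : Nonempty Formula := ⟨.bot⟩
  Function.invFun code

theorem Formula.ofCode_code (φ : Formula) : ofCode φ.code = φ :=
  haveI : Nonempty Formula := ⟨.bot⟩
  Function.leftInverse_invFun code_injective φ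

namespace KripkeModel

variable {W D : Type} [LinearOrder W] (M : KripkeModel W D)

/-- The world and the individual with a given name, the names of witnesses being `witName`. -/
noncomputable def named (w₀ : W) (d₀ d₁ : D) : ℕ → W × D
  | 0 => (w₀, d₀)
  | 1 => (w₀, d₁)
  | n + 2 => (M.exists_witness (named w₀ d₀ d₁ n.unpair.1).1
      (pick (named w₀ d₀ d₁ n.unpair.2.unpair.2.unpair.1).2
        (named w₀ d₀ d₁ n.unpair.2.unpair.2.unpair.2).2)
      (Formula.ofCode n.unpair.2.unpair.1)).choose
  termination_by n => n
  decreasing_by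
    all_goals
      have h1 := Nat.unpair_left_le n
      have h2 := Nat.unpair_right_le n
      have h3 := Nat.unpair_right_le n.unpair.2
      have h4 := Nat.unpair_left_le n.unpair.2.unpair.2
      have h5 := Nat.unpair_right_le n.unpair.2.unpair.2
      omega

variable {w₀ : W} {d₀ d₁ : D}

theorem named_witName (w ψ a b : ℕ) :
    (M.named w₀ d₀ d₁ w).1 ≤ (M.named w₀ d₀ d₁ (witName w ψ a b)).1 ∧
    M.Witness (M.named w₀ d₀ d₁ w).1 (pick (M.named w₀ d₀ d₁ a).2 (M.named w₀ d₀ d₁ b).2)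
      (Formula.ofCode ψ) (M.named w₀ d₀ d₁ (witName w ψ a b)) := by
  rw [witName, named]
  simp only [Nat.unpair_pair]
  exact Exists.choose_spec (M.exists_witness _ _ _)

theorem le_named (n : ℕ) : w₀ ≤ (M.named w₀ d₀ d₁ n).1 := by
  induction n using Nat.strong_induction_on with
  | _ n ih =>
    match n with
    | 0 => simp [named]
    | 1 => simp [named]
    | n + 2 =>
      have h := (M.named_witName (w₀ := w₀) (d₀ := d₀) (d₁ := d₁) n.unpair.1 n.unpair.2.unpair.1
        n.unpair.2.unpair.2.unpair.1 n.unpair.2.unpair.2.unpair.2).1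
      simp only [witName, Nat.pair_unpair] at h
      exact (ih _ (by have := Nat.unpair_left_le n; omega)).trans h

end KripkeModel

theorem forces_update_pick {W : Type} [PartialOrder W] {D : Type} (M : KripkeModel W D)
    {ok : ℕ → List ℕ → Bool} (hok : ∀ i l, ok i l = true → ∀ m ∈ l, m < 2) {φ : Formula}
    (hφ : φ.Good ok) {x : ℕ} (hx : x < 2) (w : W) (f : ℕ → D) (a b d : ℕ) :
    M.Forces w (Function.update (pick (f a) (f b)) x (f d)) φ ↔
      M.Forces w (pick (f (updFst x a d)) (f (updSnd x b d))) φ := by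
  refine M.forces_congr fun m hm => ?_
  have hm := hφ.lt_two hok m hm
  obtain rfl | rfl : x = 0 ∨ x = 1 := by omega
  · obtain rfl | rfl : m = 0 ∨ m = 1 := by omega
    · simp [pick, updFst]
    · simp [pick, updSnd]
  · obtain rfl | rfl : m = 0 ∨ m = 1 := by omega
    · simp [pick, updFst]
    · simp [pick, updSnd]

/-- A linear Kripke model, with the Skolem hull of an initial world and two initial individuals
named by natural numbers, is a named model. -/
noncomputable def KripkeModel.toNamed {W : Type} [LinearOrder W] {D : Type} (M : KripkeModel W D)
    {ok : ℕ → List ℕ → Bool} (hok : ∀ i l, ok i l = true → ∀ m ∈ l, m < 2) (k : ℕ)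
    {w₀ : W} {d₀ d₁ : D} (h₀ : d₀ ∈ M.dom w₀) (h₁ : d₁ ∈ M.dom w₀)
    (hk : ∀ φ : Formula, φ.Good ok → φ.code = k → ¬ M.Forces w₀ (pick d₀ d₁) φ) :
    NamedModel ok k where
  le w v := (M.named w₀ d₀ d₁ w).1 ≤ (M.named w₀ d₀ d₁ v).1
  dom w d := (M.named w₀ d₀ d₁ d).2 ∈ M.dom (M.named w₀ d₀ d₁ w).1
  holds w ψ a b := M.Forces (M.named w₀ d₀ d₁ w).1
    (pick (M.named w₀ d₀ d₁ a).2 (M.named w₀ d₀ d₁ b).2) (.ofCode ψ)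
  atom w i l := ∃ n, ∃ t : Fin n → ℕ, List.ofFn t = l ∧
    (fun j => (M.named w₀ d₀ d₁ (t j)).2) ∈ M.I (M.named w₀ d₀ d₁ w).1 n i
  bad ψ := ¬ ∃ φ : Formula, φ.Good ok ∧ φ.code = ψ
  le_refl _ := le_rfl
  le_trans _ _ _ := le_trans
  le_total _ _ := le_total _ _
  zero_le w := by simpa [named] using M.le_named w
  dom_mono _ _ _ h hd := M.dom_mono _ _ h hd
  dom_zero := by simpa [named] using h₀
  dom_one := by simpa [named] using h₁
  atom_mono := by
    rintro w v i l h ⟨n, t, hl, ht⟩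
    exact ⟨n, t, hl, M.I_mono _ _ _ _ h ht⟩
  holds_mono _ _ _ _ _ h hw := M.forces_mono h hw
  not_bad_bot h := h ⟨.bot, trivial, rfl⟩
  bad_atom i l := by
    constructor
    · intro h
      by_contra hn
      refine h ⟨.atom l.length i l.get, ?_, ?_⟩
      · simpa [Formula.Good] using hn
      · simp [Formula.code, atomCode]
    · rintro h ⟨φ, hφ, hc⟩
      cases φ <;> simp only [Formula.code, atomCode, Nat.pair_eq_pair] at hc
      case atom n j x =>
        obtain ⟨-, rfl, hx⟩ := hc
        obtain rfl := Encodable.encode_injective hx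
        simp_all [Formula.Good]
      all_goals omega
  bad_and φ ψ h := by
    by_contra! hn
    obtain ⟨⟨φ, h1, rfl⟩, ⟨ψ, h2, rfl⟩⟩ := hn
    exact h ⟨.and φ ψ, ⟨h1, h2⟩, rfl⟩
  bad_or φ ψ h := by
    by_contra! hn
    obtain ⟨⟨φ, h1, rfl⟩, ⟨ψ, h2, rfl⟩⟩ := hn
    exact h ⟨.or φ ψ, ⟨h1, h2⟩, rfl⟩
  bad_imp φ ψ h := by
    by_contra! hn
    obtain ⟨⟨φ, h1, rfl⟩, ⟨ψ, h2, rfl⟩⟩ := hn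
    exact h ⟨.imp φ ψ, ⟨h1, h2⟩, rfl⟩
  bad_all_zero φ h := by
    rintro ⟨φ, h1, rfl⟩
    exact h ⟨.all 0 φ, ⟨by omega, h1⟩, rfl⟩
  bad_all_one φ h := by
    rintro ⟨φ, h1, rfl⟩
    exact h ⟨.all 1 φ, ⟨by omega, h1⟩, rfl⟩
  bad_ex_zero φ h := by
    rintro ⟨φ, h1, rfl⟩
    exact h ⟨.ex 0 φ, ⟨by omega, h1⟩, rfl⟩
  bad_ex_one φ h := by
    rintro ⟨φ, h1, rfl⟩
    exact h ⟨.ex 1 φ, ⟨by omega, h1⟩, rfl⟩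
  holds_bot w a b := by
    have : Formula.ofCode (Nat.pair 0 0) = .bot := Formula.ofCode_code .bot
    rw [this]
    exact id
  holds_atom w i l a b h := by
    obtain ⟨χ, hχ, hc⟩ := not_not.mp h
    rw [← hc, Formula.ofCode_code]
    cases χ <;> simp only [Formula.code, atomCode, Nat.pair_eq_pair] at hc
    case atom n j x =>
      obtain ⟨-, rfl, hx⟩ := hc
      obtain rfl := Encodable.encode_injective hx
      have hp : ∀ j, (M.named w₀ d₀ d₁ (pick a b (x j))).2 =
          pick (M.named w₀ d₀ d₁ a).2 (M.named w₀ d₀ d₁ b).2 (x j) := by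
        intro j
        unfold pick
        split_ifs <;> rfl
      rw [List.map_ofFn]
      constructor
      · intro hf
        refine ⟨n, _, rfl, ?_⟩
        simp only [Function.comp, hp]
        exact hf
      · rintro ⟨m, t, ht, hf⟩
        cases List.ofFn_inj'.mp ht
        simp only [Function.comp, hp] at hf
        exact hf
    all_goals omega
  holds_and w φ ψ a b h := by
    obtain ⟨χ, hχ, hc⟩ := not_not.mp h
    rw [← hc, Formula.ofCode_code]
    cases χ <;> simp only [Formula.code, binCode, Nat.pair_eq_pair] at hc
    case and φ' ψ' =>
      obtain ⟨-, rfl, rfl⟩ := hc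
      rw [Formula.ofCode_code, Formula.ofCode_code]
      rfl
    all_goals omega
  holds_or w φ ψ a b h := by
    obtain ⟨χ, hχ, hc⟩ := not_not.mp h
    rw [← hc, Formula.ofCode_code]
    cases χ <;> simp only [Formula.code, binCode, Nat.pair_eq_pair] at hc
    case or φ' ψ' =>
      obtain ⟨-, rfl, rfl⟩ := hc
      rw [Formula.ofCode_code, Formula.ofCode_code]
      rfl
    all_goals omega
  of_holds_imp w v φ ψ a b h := by
    obtain ⟨χ, hχ, hc⟩ := not_not.mp h
    rw [← hc, Formula.ofCode_code]
    cases χ <;> simp only [Formula.code, binCode, Nat.pair_eq_pair] at hc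
    case imp φ' ψ' =>
      obtain ⟨-, rfl, rfl⟩ := hc
      rw [Formula.ofCode_code, Formula.ofCode_code]
      exact fun hw hv => hw _ hv
    all_goals omega
  of_not_holds_imp w φ ψ a b h := by
    have hwit := M.named_witName (w₀ := w₀) (d₀ := d₀) (d₁ := d₁) w (binCode 4 φ ψ) a b
    obtain ⟨χ, hχ, hc⟩ := not_not.mp h
    rw [← hc, Formula.ofCode_code] at hwit ⊢
    cases χ <;> simp only [Formula.code, binCode, Nat.pair_eq_pair] at hc
    case imp φ' ψ' =>
      obtain ⟨-, rfl, rfl⟩ := hc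
      rw [Formula.ofCode_code, Formula.ofCode_code]
      exact fun hw => ⟨hwit.1, hwit.2 hw⟩
    all_goals omega
  of_holds_all w v x φ a b d h := by
    obtain ⟨χ, hχ, hc⟩ := not_not.mp h
    rw [← hc, Formula.ofCode_code]
    cases χ <;> simp only [Formula.code, binCode, Nat.pair_eq_pair] at hc
    case all y φ' =>
      obtain ⟨-, rfl, rfl⟩ := hc
      rw [Formula.ofCode_code]
      exact fun hw hv hd => (forces_update_pick M hok hχ.2 hχ.1 _
        (fun n => (M.named w₀ d₀ d₁ n).2) a b d).mp (hw _ hv _ hd)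
    all_goals omega
  of_not_holds_all w x φ a b h := by
    have hwit := M.named_witName (w₀ := w₀) (d₀ := d₀) (d₁ := d₁) w (binCode 5 x φ) a b
    obtain ⟨χ, hχ, hc⟩ := not_not.mp h
    rw [← hc, Formula.ofCode_code] at hwit ⊢
    cases χ <;> simp only [Formula.code, binCode, Nat.pair_eq_pair] at hc
    case all y φ' =>
      obtain ⟨-, rfl, rfl⟩ := hc
      rw [Formula.ofCode_code]
      exact fun hw => ⟨hwit.1, (hwit.2 hw).1, fun hf => (hwit.2 hw).2
        ((forces_update_pick M hok hχ.2 hχ.1 _ (fun n => (M.named w₀ d₀ d₁ n).2) a b _).mpr hf)⟩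
    all_goals omega
  of_holds_ex w x φ a b h := by
    have hwit := M.named_witName (w₀ := w₀) (d₀ := d₀) (d₁ := d₁) w (binCode 6 x φ) a b
    obtain ⟨χ, hχ, hc⟩ := not_not.mp h
    rw [← hc, Formula.ofCode_code] at hwit ⊢
    cases χ <;> simp only [Formula.code, binCode, Nat.pair_eq_pair] at hc
    case ex y φ' =>
      obtain ⟨-, rfl, rfl⟩ := hc
      rw [Formula.ofCode_code]
      exact fun hw => ⟨(hwit.2 hw).1,
        (forces_update_pick M hok hχ.2 hχ.1 _ (fun n => (M.named w₀ d₀ d₁ n).2) a b _).mp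
          (hwit.2 hw).2⟩
    all_goals omega
  of_not_holds_ex w x φ a b d h := by
    obtain ⟨χ, hχ, hc⟩ := not_not.mp h
    rw [← hc, Formula.ofCode_code]
    cases χ <;> simp only [Formula.code, binCode, Nat.pair_eq_pair] at hc
    case ex y φ' =>
      obtain ⟨-, rfl, rfl⟩ := hc
      rw [Formula.ofCode_code]
      exact fun hw hd hf => hw ⟨_, hd, (forces_update_pick M hok hχ.2 hχ.1 _
        (fun n => (M.named w₀ d₀ d₁ n).2) a b d).mpr hf⟩
    all_goals omega
  root := by
    by_cases h : ∃ φ : Formula, φ.Good ok ∧ φ.code = k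
    · obtain ⟨φ, hφ, rfl⟩ := h
      right
      rw [Formula.ofCode_code]
      simpa [named] using hk φ hφ rfl
    · exact .inl h

theorem isEmpty_namedModel_iff {ok : ℕ → List ℕ → Bool}
    (hok : ∀ i l, ok i l = true → ∀ m ∈ l, m < 2) (k : ℕ) :
    IsEmpty (NamedModel ok k) ↔ ∃ φ : Formula, (φ ∈ QLC ∧ φ.Good ok) ∧ φ.code = k := by
  constructor
  · intro hE
    by_contra! hn
    by_cases hg : ∃ φ : Formula, φ.Good ok ∧ φ.code = k
    · obtain ⟨φ, hφ, rfl⟩ := hg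
      have : φ ∉ QLC := fun h => hn φ ⟨h, hφ⟩ rfl
      simp only [QLC, FrameValid, KripkeModel.IsTrue, Set.mem_ofPred_eq, not_forall] at this
      obtain ⟨W, _, D, M, w, g, hg, hf⟩ := this
      -- Variables without free occurrence are sent into the domain of `w` as well.
      obtain ⟨d, hd⟩ := M.dom_nonempty w
      let g' : ℕ → D := fun m => if m ∈ φ.freeVars then g m else d
      have hg' : ∀ m, g' m ∈ M.dom w := by
        intro m
        simp only [g']
        split_ifs with h
        exacts [hg m h, hd]
      refine hE.false (M.toNamed hok φ.code (hg' 0) (hg' 1) ?_)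
      intro ψ _ hc hψ
      obtain rfl := Formula.code_injective hc
      refine hf ((M.forces_congr fun m hm => ?_).mp hψ)
      have : m = 0 ∨ m = 1 := by have := hφ.lt_two hok m hm; omega
      obtain rfl | rfl := this <;> simp [pick, g', hm]
    -- If `k` is not the code of an admissible formula, then any model has a suitable named model.
    · let M : KripkeModel Unit Unit :=
        { dom := fun _ => Set.univ
          dom_nonempty := fun _ => Set.univ_nonempty
          dom_mono := fun _ _ _ => le_rfl
          I := fun _ _ _ => ∅
          I_dom := fun _ _ _ _ h => h.elim
          I_mono := fun _ _ _ _ _ => le_rfl }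
      exact hE.false (M.toNamed hok k (w₀ := ()) (d₀ := ()) (d₁ := ()) trivial trivial
        fun φ hφ hc => absurd ⟨φ, hφ, hc⟩ hg)
  · rintro ⟨φ, ⟨hQ, hφ⟩, hk⟩
    exact ⟨fun N => N.not_mem_QLC hok hφ hk hQ⟩

/-! ### Recursive enumerability of the fragments -/

theorem Formula.good_iff_vars (φ : Formula) :
    φ.Good (fun _ l => l.all (· < 2)) ↔ φ ∈ twoVariable := by
  have hsing : ∀ x : ℕ, x < 2 ↔ x ∈ ({0, 1} : Finset ℕ) := by intro x; simp; omega
  simp only [twoVariable, Set.mem_ofPred_eq]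
  induction φ with
  | bot => simp [Good, vars]
  | atom n i x =>
    simp only [Good, vars, List.all_eq_true, List.mem_ofFn, Finset.image_subset_iff, ← hsing]
    simp
  | and φ ψ h1 h2 => simp only [Good, vars, h1, h2, Finset.union_subset_iff]
  | or φ ψ h1 h2 => simp only [Good, vars, h1, h2, Finset.union_subset_iff]
  | imp φ ψ h1 h2 => simp only [Good, vars, h1, h2, Finset.union_subset_iff]
  | all x φ h => exact (and_congr (hsing x) h).trans Finset.insert_subset_iff.symm
  | ex x φ h => exact (and_congr (hsing x) h).trans Finset.insert_subset_iff.symm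

theorem Formula.good_iff_vars_letters (φ : Formula) :
    φ.Good (fun i l => l.all (· < 2) && (l.length == 1 || (l.length == 2 && i == 0))) ↔
      φ ∈ twoVariable ∩ oneBinaryRestUnary := by
  rw [Set.mem_inter_iff, ← good_iff_vars]
  simp only [oneBinaryRestUnary, Set.mem_ofPred_eq]
  induction φ with
  | bot => simp [Good, letters]
  | atom n i x => simp [Good, letters]
  | and φ ψ h1 h2 => simp only [Good, letters, Finset.mem_union, h1, h2]; grind
  | or φ ψ h1 h2 => simp only [Good, letters, Finset.mem_union, h1, h2]; grind
  | imp φ ψ h1 h2 => simp only [Good, letters, Finset.mem_union, h1, h2]; grind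
  | all x φ h => simp only [Good, letters, h]; tauto
  | ex x φ h => simp only [Good, letters, h]; tauto

theorem rePred_of_good {ok : ℕ → List ℕ → Bool} (hp : Primrec₂ ok)
    (hok : ∀ i l, ok i l = true → ∀ m ∈ l, m < 2) {Γ : Set Formula}
    (hΓ : ∀ φ, φ ∈ Γ ↔ φ ∈ QLC ∧ φ.Good ok) :
    REPred fun k : ℕ => k ∈ Formula.code '' Γ :=
  (rePred_isEmpty_namedModel hp).of_eq fun k => by
    rw [isEmpty_namedModel_iff hok]
    simp only [Set.mem_image, hΓ]

theorem primrec_all_lt_two : Primrec fun l : List ℕ => l.all (· < 2) := by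
  have h : PrimrecPred fun m : ℕ => m < 2 := Primrec.nat_lt.comp Primrec.id (.const 2)
  exact (PrimrecPred.forall_mem_list h).decide.of_eq fun l => by
    rw [Bool.eq_iff_iff]; simp

theorem rePred_QLC_twoVariable : REPred fun k : ℕ => k ∈ Formula.code '' (QLC ∩ twoVariable) := by
  refine rePred_of_good (ok := fun _ l => l.all (· < 2)) (primrec_all_lt_two.comp Primrec.snd)
    (fun i l h => by simpa using h) fun φ => ?_
  rw [Formula.good_iff_vars, Set.mem_inter_iff]

theorem rePred_QLC_twoVariable_letters : REPred fun k : ℕ =>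
    k ∈ Formula.code '' (QLC ∩ twoVariable ∩ oneBinaryRestUnary) := by
  refine rePred_of_good (ok := fun i l => l.all (· < 2) &&
    (l.length == 1 || (l.length == 2 && i == 0))) ?_ (fun i l h => ?_) fun φ => ?_
  · have hl : Primrec fun q : ℕ × List ℕ => q.2.length := Primrec.list_length.comp Primrec.snd
    exact Primrec.and.comp (primrec_all_lt_two.comp Primrec.snd) (Primrec.or.comp
      (Primrec.beq.comp hl (.const 1)) (Primrec.and.comp (Primrec.beq.comp hl (.const 2))
        (Primrec.beq.comp Primrec.fst (.const 0))))
  · simp only [Bool.and_eq_true, List.all_eq_true, decide_eq_true_eq] at h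
    exact h.1
  · rw [Formula.good_iff_vars_letters, Set.inter_assoc, Set.mem_inter_iff]

/-! ### Positive rules in two variables -/

/-- Positive existential formulas in two variables, called `false` and `true`, over unary
predicates `P` and unary functions ("registers") `R` into a set of values; `eq r x s y` says that
the register `r` of `x` and the register `s` of `y` have the same value. -/
inductive Pos (P R : Type) : Type
  | pred (p : P) (x : Bool)
  | eq (r : R) (x : Bool) (s : R) (y : Bool)
  | and (θ η : Pos P R)
  | ex (x : Bool) (θ : Pos P R)

/-- A structure with elements in `E` and register values in `V`. -/
structure RegStructure (P R E V : Type) where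
  pred : P → E → Prop
  reg : R → E → V

namespace RegStructure

variable {P R E V : Type} (S : RegStructure P R E V)

/-- Truth of a positive formula, with `a` and `b` as the values of the variables `false` and
`true`. -/
def Sat : E → E → Pos P R → Prop
  | a, b, .pred p x => S.pred p (cond x b a)
  | a, b, .eq r x s y => S.reg r (cond x b a) = S.reg s (cond y b a)
  | a, b, .and θ η => Sat a b θ ∧ Sat a b η
  | _, b, .ex false θ => ∃ d, Sat d b θ
  | a, _, .ex true θ => ∃ d, Sat a d θ

/-- A rule `(θ, η)` is read as the universal closure of the implication from `θ` to `η`. -/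
def Models (ρ : Pos P R × Pos P R) : Prop :=
  ∀ a b, S.Sat a b ρ.1 → S.Sat a b ρ.2

end RegStructure

namespace Pos

variable {P R : Type} (ℓ : P ⊕ R → ℕ)

/-- The unary atom with the letter of the symbol `p`. -/
def unary (p : P ⊕ R) (x : ℕ) : Formula := .atom 1 (ℓ p) fun _ => x

/-- The translation of positive formulas into intuitionistic formulas with unary letters, numbered
by `ℓ`. The value of a register at an element is the set of worlds where its letter holds of the
element, and equality of values is equivalence. -/
def toFormula : Pos P R → Formula
  | .pred p x => unary ℓ (.inl p) x.toNat
  | .eq r x s y => .and (.imp (unary ℓ (.inr r) x.toNat) (unary ℓ (.inr s) y.toNat))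
      (.imp (unary ℓ (.inr s) y.toNat) (unary ℓ (.inr r) x.toNat))
  | .and θ η => .and θ.toFormula η.toFormula
  | .ex x θ => .ex x.toNat θ.toFormula

/-- The sentence to be derived from the rules, which plays the role of falsity. -/
def goalFormula (goal : P) : Formula := .ex 0 (unary ℓ (.inl goal) 0)

/-- The translation of a rule. The disjunction with the goal makes the rule trivial at the worlds
where the goal holds. -/
def ruleFormula (goal : P) (ρ : Pos P R × Pos P R) : Formula :=
  .all 0 (.all 1 (.imp (ρ.1.toFormula ℓ) (.or (ρ.2.toFormula ℓ) (goalFormula ℓ goal))))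

/-- The conjunction of the translations of rules. -/
def rulesFormula (goal : P) : List (Pos P R × Pos P R) → Formula
  | [] => .imp .bot .bot
  | ρ :: rs => .and (ruleFormula ℓ goal ρ) (rulesFormula goal rs)

/-- The sentence "the rules and the existential closure of `θ` entail the goal". -/
def entailment (goal : P) (rs : List (Pos P R × Pos P R)) (θ : Pos P R) : Formula :=
  .imp (.and (rulesFormula ℓ goal rs) (.ex 0 (.ex 1 (θ.toFormula ℓ)))) (goalFormula ℓ goal)

variable {ℓ}

/-- The formula has no variables besides `0`, `1`, and only unary letters. -/
def _root_.IntPred.Formula.TwoVarUnary (φ : Formula) : Prop :=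
  φ.vars ⊆ {0, 1} ∧ ∀ p ∈ φ.letters, p.1 = 1

theorem twoVarUnary_unary (p : P ⊕ R) {x : ℕ} (hx : x < 2) : (unary ℓ p x).TwoVarUnary := by
  constructor
  · intro m
    simp [unary, Formula.vars]
    omega
  · simp [unary, Formula.letters]

theorem twoVarUnary_toFormula (θ : Pos P R) : (θ.toFormula ℓ).TwoVarUnary := by
  have hb : ∀ x : Bool, x.toNat < 2 := Bool.toNat_lt
  have hv : ∀ x : Bool, x.toNat ∈ ({0, 1} : Finset ℕ) := by decide
  induction θ with
  | pred p x => exact twoVarUnary_unary _ (hb x)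
  | eq r x s y =>
    have h1 := twoVarUnary_unary (ℓ := ℓ) (.inr r : P ⊕ R) (hb x)
    have h2 := twoVarUnary_unary (ℓ := ℓ) (.inr s : P ⊕ R) (hb y)
    simp only [Formula.TwoVarUnary, toFormula, Formula.vars, Formula.letters, Finset.mem_union,
      Finset.union_subset_iff] at *
    grind
  | and θ η h1 h2 =>
    simp only [Formula.TwoVarUnary, toFormula, Formula.vars, Formula.letters, Finset.mem_union,
      Finset.union_subset_iff] at *
    grind
  | ex x θ h => exact ⟨Finset.insert_subset (hv x) h.1, h.2⟩

theorem twoVarUnary_goalFormula (goal : P) : (goalFormula ℓ goal).TwoVarUnary := by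
  have h := twoVarUnary_unary (ℓ := ℓ) (.inl goal : P ⊕ R) (x := 0) (by omega)
  exact ⟨Finset.insert_subset (by simp) h.1, h.2⟩

theorem twoVarUnary_ruleFormula (goal : P) (ρ : Pos P R × Pos P R) :
    (ruleFormula ℓ goal ρ).TwoVarUnary := by
  have h1 := twoVarUnary_toFormula (ℓ := ℓ) ρ.1
  have h2 := twoVarUnary_toFormula (ℓ := ℓ) ρ.2
  have h3 := twoVarUnary_goalFormula (ℓ := ℓ) goal
  simp only [Formula.TwoVarUnary, ruleFormula, Formula.vars, Formula.letters, Finset.mem_union,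
    Finset.union_subset_iff, Finset.insert_subset_iff] at *
  simp; grind

theorem twoVarUnary_entailment (goal : P) (rs : List (Pos P R × Pos P R)) (θ : Pos P R) :
    (entailment ℓ goal rs θ).TwoVarUnary := by
  have h1 : (rulesFormula ℓ goal rs).TwoVarUnary := by
    induction rs with
    | nil => simp [rulesFormula, Formula.TwoVarUnary, Formula.vars, Formula.letters]
    | cons ρ rs ih =>
      have h := twoVarUnary_ruleFormula (ℓ := ℓ) goal ρ
      simp only [Formula.TwoVarUnary, rulesFormula, Formula.vars, Formula.letters,
        Finset.mem_union, Finset.union_subset_iff] at *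
      grind
  have h2 := twoVarUnary_toFormula (ℓ := ℓ) θ
  have h3 := twoVarUnary_goalFormula (ℓ := ℓ) goal
  simp only [Formula.TwoVarUnary, entailment, Formula.vars, Formula.letters, Finset.mem_union,
    Finset.union_subset_iff, Finset.insert_subset_iff] at *
  simp; grind

end Pos

open Pos

section Reduction

variable {P R : Type}

/-- The structure seen at a world of a Kripke model: the value of a register is the set of later
worlds where its letter holds. -/
def KripkeModel.structureAt {W D : Type} [PartialOrder W] (M : KripkeModel W D) (ℓ : P ⊕ R → ℕ)
    (w : W) : RegStructure P R (M.dom w) (Set W) where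
  pred p e := (fun _ => e.1) ∈ M.I w 1 (ℓ (.inl p))
  reg r e := {v | w ≤ v ∧ (fun _ => e.1) ∈ M.I v 1 (ℓ (.inr r))}

theorem KripkeModel.forces_toFormula_iff {W D : Type} [PartialOrder W] (M : KripkeModel W D)
    (ℓ : P ⊕ R → ℕ) (w : W) (θ : Pos P R) (g : ℕ → D) (a b : M.dom w) (ha : g 0 = a)
    (hb : g 1 = b) :
    M.Forces w g (θ.toFormula ℓ) ↔ (M.structureAt ℓ w).Sat a b θ := by
  have hx : ∀ (g : ℕ → D) (a b : M.dom w), g 0 = a → g 1 = b →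
      ∀ x : Bool, g x.toNat = (cond x b a : M.dom w) := by
    rintro g a b ha hb (_ | _)
    exacts [ha, hb]
  induction θ generalizing g a b with
  | pred p x => simp [Pos.toFormula, unary, Forces, RegStructure.Sat, structureAt, hx g a b ha hb]
  | eq r x s y =>
    simp only [Pos.toFormula, unary, Forces, RegStructure.Sat, structureAt, hx g a b ha hb,
      Set.ext_iff, Set.mem_ofPred_eq]
    exact ⟨fun h v => ⟨fun ⟨hv, k⟩ => ⟨hv, h.1 v hv k⟩, fun ⟨hv, k⟩ => ⟨hv, h.2 v hv k⟩⟩,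
      fun h => ⟨fun v hv k => ((h v).mp ⟨hv, k⟩).2, fun v hv k => ((h v).mpr ⟨hv, k⟩).2⟩⟩
  | and θ η h1 h2 => exact and_congr (h1 g a b ha hb) (h2 g a b ha hb)
  | ex x θ ih =>
    cases x
    · constructor
      · rintro ⟨d, hd, h⟩
        exact ⟨⟨d, hd⟩, (ih _ ⟨d, hd⟩ b (by simp) (by simpa using hb)).mp h⟩
      · rintro ⟨d, h⟩
        exact ⟨d, d.2, (ih _ d b (by simp) (by simpa using hb)).mpr h⟩
    · constructor
      · rintro ⟨d, hd, h⟩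
        exact ⟨⟨d, hd⟩, (ih _ a ⟨d, hd⟩ (by simpa using ha) (by simp)).mp h⟩
      · rintro ⟨d, h⟩
        exact ⟨d, d.2, (ih _ a d (by simpa using ha) (by simp)).mpr h⟩

theorem KripkeModel.models_of_forces {W D : Type} [PartialOrder W] {M : KripkeModel W D}
    {ℓ : P ⊕ R → ℕ} {w : W} {g : ℕ → D} {goal : P} {rs : List (Pos P R × Pos P R)}
    (h : M.Forces w g (rulesFormula ℓ goal rs))
    (hgoal : ∀ e, ¬ (M.structureAt ℓ w).pred goal e) :
    ∀ ρ ∈ rs, (M.structureAt ℓ w).Models ρ := by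
  induction rs with
  | nil => simp
  | cons σ rs ih =>
    obtain ⟨h1, h2⟩ := h
    refine List.forall_mem_cons.mpr ⟨fun a b hab => ?_, ih h2⟩
    have h3 := h1 w le_rfl a a.2 w le_rfl b b.2 w le_rfl
      ((M.forces_toFormula_iff ℓ w σ.1 _ a b (by simp) (by simp)).mpr hab)
    rcases h3 with h3 | ⟨e, he, h3⟩
    · exact (M.forces_toFormula_iff ℓ w σ.2 _ a b (by simp) (by simp)).mp h3
    · exact absurd (by simpa [unary, Forces, structureAt] using h3) (hgoal ⟨e, he⟩)

/-- A refutation of the entailment, in whatever model, yields a structure that satisfies the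
rules. -/
theorem exists_regStructure_of_not_mem_QLC {ℓ : P ⊕ R → ℕ} {goal : P}
    {rs : List (Pos P R × Pos P R)} {θ : Pos P R} (h : entailment ℓ goal rs θ ∉ QLC) :
    ∃ (E V : Type) (S : RegStructure P R E V), (∀ e, ¬ S.pred goal e) ∧
      (∀ ρ ∈ rs, S.Models ρ) ∧ ∃ a b, S.Sat a b θ := by
  simp only [QLC, FrameValid, KripkeModel.IsTrue, Set.mem_ofPred_eq, not_forall] at h
  obtain ⟨W, _, D, M, w, g, -, h⟩ := h
  simp only [entailment, KripkeModel.Forces, not_forall] at h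
  obtain ⟨v, -, ⟨hr, a, ha, b, hb, hθ⟩, hv⟩ := h
  have hgoal : ∀ e, ¬ (M.structureAt ℓ v).pred goal e := fun e he =>
    hv ⟨e, e.2, by simpa [unary, KripkeModel.Forces, KripkeModel.structureAt] using he⟩
  exact ⟨_, _, M.structureAt ℓ v, hgoal, KripkeModel.models_of_forces hr hgoal, ⟨a, ha⟩, ⟨b, hb⟩,
    (M.forces_toFormula_iff ℓ v θ _ _ _ (by simp) (by simp)).mp hθ⟩

variable {E V : Type} (S : RegStructure P R E V) (ℓ : P ⊕ R → ℕ) (f : V → ℕ)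

/-- The Kripke model of a structure with countably many register values: worlds are natural
numbers, the predicates are evaluated at the root `0` and trivial afterwards, and a register
with value number `n` becomes the cut of the worlds above `n`. -/
def RegStructure.toKripke [Nonempty E] : KripkeModel ℕ E where
  dom _ := Set.univ
  dom_nonempty _ := Set.univ_nonempty
  dom_mono _ _ _ := le_rfl
  I w n i := {t | ∃ j : Fin n, (∃ p, ℓ (.inl p) = i ∧ (0 < w ∨ S.pred p (t j))) ∨
    ∃ r, ℓ (.inr r) = i ∧ f (S.reg r (t j)) < w}
  I_dom _ _ _ _ _ _ := trivial
  I_mono := by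
    rintro w v n i h t ⟨j, ⟨p, hp, hw⟩ | ⟨r, hr, hw⟩⟩
    · exact ⟨j, .inl ⟨p, hp, hw.imp_left fun hw => hw.trans_le h⟩⟩
    · exact ⟨j, .inr ⟨r, hr, hw.trans_le h⟩⟩

variable {ℓ f}

theorem RegStructure.toKripke_forces_iff [Nonempty E] (hℓ : ℓ.Injective) (hf : f.Injective)
    (θ : Pos P R) (g : ℕ → E) :
    (S.toKripke ℓ f).Forces 0 g (θ.toFormula ℓ) ↔ S.Sat (g 0) (g 1) θ := by
  have hx : ∀ (g : ℕ → E) (x : Bool), g x.toNat = cond x (g 1) (g 0) := by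
    rintro g (_ | _) <;> rfl
  induction θ generalizing g with
  | pred p x =>
    simp [Pos.toFormula, unary, KripkeModel.Forces, Sat, toKripke, hx, hℓ.eq_iff]
  | eq r x s y =>
    simp only [Pos.toFormula, unary, KripkeModel.Forces, Sat, toKripke, hx, hℓ.eq_iff]
    simp only [Nat.zero_le, reduceCtorEq, false_and, exists_false, false_or, Set.mem_ofPred_eq,
      Sum.inr.injEq, exists_eq_left, Fin.exists_fin_one, forall_const]
    rw [← hf.eq_iff]
    constructor
    · rintro ⟨h1, h2⟩
      have h1 := h1 (f (S.reg r (cond x (g 1) (g 0))) + 1) (by omega)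
      have h2 := h2 (f (S.reg s (cond y (g 1) (g 0))) + 1) (by omega)
      omega
    · intro h
      simp [h]
  | and θ η h1 h2 => exact and_congr (h1 g) (h2 g)
  | ex x θ ih =>
    cases x
    · constructor
      · rintro ⟨d, -, h⟩
        exact ⟨d, by simpa using (ih _).mp h⟩
      · rintro ⟨d, h⟩
        exact ⟨d, trivial, (ih _).mpr (by simpa using h)⟩
    · constructor
      · rintro ⟨d, -, h⟩
        exact ⟨d, by simpa using (ih _).mp h⟩
      · rintro ⟨d, h⟩
        exact ⟨d, trivial, (ih _).mpr (by simpa using h)⟩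

theorem RegStructure.toKripke_forces_goalFormula [Nonempty E] (goal : P) {w : ℕ} (hw : 0 < w)
    (g : ℕ → E) : (S.toKripke ℓ f).Forces w g (goalFormula ℓ goal) :=
  ⟨Classical.arbitrary E, trivial, 0, .inl ⟨goal, rfl, .inl hw⟩⟩

theorem RegStructure.toKripke_forces_rulesFormula [Nonempty E] (hℓ : ℓ.Injective)
    (hf : f.Injective) (goal : P) {rs : List (Pos P R × Pos P R)} (h : ∀ ρ ∈ rs, S.Models ρ)
    (g : ℕ → E) : (S.toKripke ℓ f).Forces 0 g (rulesFormula ℓ goal rs) := by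
  induction rs with
  | nil => exact fun _ _ => id
  | cons ρ rs ih =>
    refine ⟨fun u _ a _ v _ b _ w _ hw => ?_, ih fun σ hσ => h σ (List.mem_cons_of_mem _ hσ)⟩
    rcases Nat.eq_zero_or_pos w with rfl | hpos
    · exact .inl ((S.toKripke_forces_iff hℓ hf _ _).mpr (h ρ List.mem_cons_self _ _
        ((S.toKripke_forces_iff hℓ hf _ _).mp hw)))
    · exact .inr (S.toKripke_forces_goalFormula goal hpos _)

/-- A structure with countably many register values that satisfies the rules yields a refutation
of the entailment. -/
theorem RegStructure.not_mem_QLC [Countable V] (hℓ : ℓ.Injective) {goal : P}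
    {rs : List (Pos P R × Pos P R)} {θ : Pos P R} (hgoal : ∀ e, ¬ S.pred goal e)
    (hrs : ∀ ρ ∈ rs, S.Models ρ) {a b : E} (hθ : S.Sat a b θ) : entailment ℓ goal rs θ ∉ QLC := by
  obtain ⟨f, hf⟩ := exists_injective_nat V
  have : Nonempty E := ⟨a⟩
  intro h
  have h := h ℕ E (S.toKripke ℓ f) 0 (fun _ => a) (fun _ _ => trivial) 0 le_rfl
    ⟨S.toKripke_forces_rulesFormula hℓ hf goal hrs _, a, trivial, b, trivial,
      (S.toKripke_forces_iff hℓ hf _ _).mpr (by simpa using hθ)⟩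
  obtain ⟨e, -, _, ⟨p, hp, he⟩ | ⟨r, -, he⟩⟩ := h
  · obtain rfl : p = goal := by simpa using hℓ hp
    exact hgoal _ (he.resolve_left (lt_irrefl _))
  · exact absurd he (Nat.not_lt_zero _)

end Reduction

/-! ### Evaluation of partial recursive functions by positive rules -/

open Turing.ToPartrec (Code)

namespace Eval

/-- The predicates of the rules for evaluation. Elements stand for natural numbers (`zero`, `suc`),
for lists of natural numbers (among them `nil`), and for calls (`call c`) of a code `c` on some
list, which may be `done`; `start` marks the call to be evaluated, and `mid`, `ifZero`, `ifSuc`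
mark calls in which certain subcalls have been evaluated or a test had a certain outcome. -/
inductive PSym : Type
  | goal | zero | suc | nil | start | mid | ifZero | ifSuc
  | call (c : Code)
  | done (c : Code)

/-- The registers of the rules for evaluation: the name of an element; head and tail of a list;
predecessor of a number; an auxiliary number, the predecessor of the head of a list; input and
output of a call, and three intermediate results. -/
inductive RSym : Type
  | nm | hd | tl | pd | aux | inp | out | mid | mhd | mtl

/-- An injective numbering of codes. -/
def codeNum : Code → ℕ
  | .zero' => Nat.pair 0 0
  | .succ => Nat.pair 1 0
  | .tail => Nat.pair 2 0
  | .cons f g => Nat.pair 3 (Nat.pair (codeNum f) (codeNum g))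
  | .comp f g => Nat.pair 4 (Nat.pair (codeNum f) (codeNum g))
  | .case f g => Nat.pair 5 (Nat.pair (codeNum f) (codeNum g))
  | .fix f => Nat.pair 6 (codeNum f)

theorem codeNum_injective : Function.Injective codeNum := by
  intro c
  induction c with
  | zero' | succ | tail => intro d h; cases d <;> simp_all [codeNum, Nat.pair_eq_pair]
  | cons f g h1 h2 | comp f g h1 h2 | case f g h1 h2 =>
    intro d h
    cases d <;> simp [codeNum, Nat.pair_eq_pair] at h
    rw [h1 h.1, h2 h.2]
  | fix f h1 =>
    intro d h
    cases d <;> simp [codeNum, Nat.pair_eq_pair] at h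
    rw [h1 h]

/-- The numbering of the letters that translate predicates and registers. -/
def letter : PSym ⊕ RSym → ℕ
  | .inl .goal => Nat.pair 0 0
  | .inl .zero => Nat.pair 1 0
  | .inl .suc => Nat.pair 2 0
  | .inl .nil => Nat.pair 3 0
  | .inl .start => Nat.pair 4 0
  | .inl .mid => Nat.pair 5 0
  | .inl .ifZero => Nat.pair 6 0
  | .inl .ifSuc => Nat.pair 7 0
  | .inl (.call c) => Nat.pair 8 (codeNum c)
  | .inl (.done c) => Nat.pair 9 (codeNum c)
  | .inr .nm => Nat.pair 10 0
  | .inr .hd => Nat.pair 11 0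
  | .inr .tl => Nat.pair 12 0
  | .inr .pd => Nat.pair 13 0
  | .inr .aux => Nat.pair 14 0
  | .inr .inp => Nat.pair 15 0
  | .inr .out => Nat.pair 16 0
  | .inr .mid => Nat.pair 17 0
  | .inr .mhd => Nat.pair 18 0
  | .inr .mtl => Nat.pair 19 0

theorem letter_injective : Function.Injective letter := by
  rintro (a | a) (b | b) h <;> cases a <;> cases b <;>
    simp_all [letter, Nat.pair_eq_pair, codeNum_injective.eq_iff]

/-- The first variable. -/
abbrev X : Bool := false
/-- The second variable. -/
abbrev Y : Bool := true

/-- The positive formulas over the symbols for evaluation. -/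
abbrev EPos : Type := Pos PSym RSym

local infixr:35 " ⩓ " => Pos.and

/-- The predicate `p` of the variable `x`. -/
abbrev is (p : PSym) (x : Bool) : EPos := .pred p x

/-- The register `r` of `x` and the register `s` of `y` agree. -/
abbrev same (r : RSym) (x : Bool) (s : RSym) (y : Bool) : EPos := .eq r x s y

/-- The call of `c` on the content of the register `r` of `x` exists. -/
abbrev spawn (c : Code) (r : RSym) : EPos := .ex Y (is (.call c) Y ⩓ same .inp Y r X)

/-- The variable `y` is the finished call of `c` on the content of the register `r` of `x`. -/
abbrev finished (c : Code) (r : RSym) : EPos :=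
  is (.call c) Y ⩓ is (.done c) Y ⩓ same .inp Y r X

/-- The tail of the empty list is the empty list, and its head is zero, in agreement with
`List.tail` and `List.headI`. -/
def nilRule : EPos × EPos :=
  (is .nil X, same .tl X .nm X ⩓ .ex Y (same .nm Y .hd X ⩓ is .zero Y))

/-- The rules for the calls of a code and of its parts. -/
def rules : Code → List (EPos × EPos)
  | .zero' =>
    [(is (.call .zero') X, is (.done .zero') X ⩓
      .ex Y (same .nm Y .out X ⩓ same .tl Y .inp X ⩓ .ex X (same .nm X .hd Y ⩓ is .zero X)))]
  | .succ =>
    [(is (.call .succ) X ⩓ same .nm Y .inp X, same .mid X .hd Y),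
     (is (.call .succ) X, is (.done .succ) X ⩓
      .ex Y (same .nm Y .out X ⩓ same .aux Y .mid X ⩓ .ex X (same .nm X .tl Y ⩓ is .nil X) ⩓
        .ex X (same .nm X .hd Y ⩓ is .suc X ⩓ same .pd X .aux Y)))]
  | .tail =>
    [(is (.call .tail) X ⩓ same .nm Y .inp X, is (.done .tail) X ⩓ same .out X .tl Y)]
  | .cons f g =>
    [(is (.call (.cons f g)) X, spawn f .inp),
     (is (.call (.cons f g)) X, spawn g .inp),
     (is (.call (.cons f g)) X ⩓ finished f .inp, is .mid X ⩓ same .mid X .out Y),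
     (is (.call (.cons f g)) X ⩓ is .mid X ⩓ same .nm Y .mid X, same .mhd X .hd Y),
     (is (.call (.cons f g)) X ⩓ is .mid X ⩓ finished g .inp,
      is (.done (.cons f g)) X ⩓ same .mtl X .out Y ⩓
        .ex Y (same .nm Y .out X ⩓ same .hd Y .mhd X ⩓ same .tl Y .mtl X))] ++
      (rules f ++ rules g)
  | .comp f g =>
    [(is (.call (.comp f g)) X, spawn g .inp),
     (is (.call (.comp f g)) X ⩓ finished g .inp, is .mid X ⩓ same .mid X .out Y ⩓ spawn f .mid),
     (is (.call (.comp f g)) X ⩓ is .mid X ⩓ finished f .mid,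
      is (.done (.comp f g)) X ⩓ same .out X .out Y)] ++ (rules f ++ rules g)
  | .case f g =>
    [(is (.call (.case f g)) X ⩓ same .nm Y .inp X, same .mhd X .hd Y ⩓ same .mtl X .tl Y),
     (is (.call (.case f g)) X ⩓ same .nm Y .mhd X ⩓ is .zero Y, is .ifZero X ⩓ spawn f .mtl),
     (is (.call (.case f g)) X ⩓ is .ifZero X ⩓ finished f .mtl,
      is (.done (.case f g)) X ⩓ same .out X .out Y),
     (is (.call (.case f g)) X ⩓ same .nm Y .mhd X ⩓ is .suc Y,
      is .ifSuc X ⩓ same .aux X .pd Y ⩓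
        .ex Y (same .nm Y .mid X ⩓ same .hd Y .aux X ⩓ same .tl Y .mtl X) ⩓ spawn g .mid),
     (is (.call (.case f g)) X ⩓ is .ifSuc X ⩓ finished g .mid,
      is (.done (.case f g)) X ⩓ same .out X .out Y)] ++ (rules f ++ rules g)
  | .fix f =>
    [(is (.call (.fix f)) X, spawn f .inp),
     (is (.call (.fix f)) X ⩓ finished f .inp, is .mid X ⩓ same .mid X .out Y),
     (is (.call (.fix f)) X ⩓ is .mid X ⩓ same .nm Y .mid X,
      same .mhd X .hd Y ⩓ same .mtl X .tl Y),
     (is (.call (.fix f)) X ⩓ is .mid X ⩓ same .nm Y .mhd X ⩓ is .zero Y,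
      is (.done (.fix f)) X ⩓ same .out X .mtl X),
     (is (.call (.fix f)) X ⩓ is .mid X ⩓ same .nm Y .mhd X ⩓ is .suc Y,
      is .ifSuc X ⩓ spawn (.fix f) .mtl),
     (is (.call (.fix f)) X ⩓ is .ifSuc X ⩓ finished (.fix f) .mtl,
      is (.done (.fix f)) X ⩓ same .out X .out Y)] ++ rules f

/-- The rules for the evaluation of `c`, the goal being that the marked call is done. -/
def program (c : Code) : List (EPos × EPos) :=
  (is .start X ⩓ is (.done c) X, is .goal X) :: nilRule :: rules c

/-- The first variable is a number equal to `k`. -/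
def numeral : ℕ → EPos
  | 0 => is .zero X
  | k + 1 => is .suc X ⩓ .ex Y (same .nm Y .pd X ⩓ .ex X (same .nm X .nm Y ⩓ numeral k))

/-- The first variable is a marked call of `c` on the list `[k]`. -/
def startCall (c : Code) (k : ℕ) : EPos :=
  is (.call c) X ⩓ is .start X ⩓ .ex Y (same .nm Y .inp X ⩓
    .ex X (same .nm X .tl Y ⩓ is .nil X) ⩓ .ex X (same .nm X .hd Y ⩓ numeral k))

section Mem

variable {f g : Code} {u v : List ℕ}

theorem mem_eval_cons :
    u ∈ (Code.cons f g).eval v ↔ ∃ a ∈ f.eval v, ∃ b ∈ g.eval v, u = a.headI :: b := by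
  simp [Part.bind_eq_bind]

theorem mem_eval_comp : u ∈ (Code.comp f g).eval v ↔ ∃ a ∈ g.eval v, u ∈ f.eval a := by
  rw [Code.comp_eval]
  exact Part.mem_bind_iff

theorem eval_case_of_eq_zero (h : v.headI = 0) : (Code.case f g).eval v = f.eval v.tail := by
  simp [h]

theorem eval_case_of_ne_zero (h : v.headI ≠ 0) :
    (Code.case f g).eval v = g.eval ((v.headI - 1) :: v.tail) := by
  obtain ⟨n, hn⟩ := Nat.exists_eq_succ_of_ne_zero h
  simp [hn]

theorem mem_eval_fix : u ∈ (Code.fix f).eval v ↔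
    ∃ a ∈ f.eval v, (a.headI = 0 ∧ u = a.tail) ∨ (a.headI ≠ 0 ∧ u ∈ (Code.fix f).eval a.tail) := by
  rw [Code.fix_eval]
  refine PFun.mem_fix_iff.trans ?_
  simp only [Part.mem_map_iff]
  constructor
  · rintro (⟨a, ha, h⟩ | ⟨a', ⟨a, ha, h⟩, h'⟩)
    · refine ⟨a, ha, ?_⟩
      split_ifs at h with h0
      · exact .inl ⟨h0, (Sum.inl.inj h).symm⟩
    · refine ⟨a, ha, ?_⟩
      split_ifs at h with h0
      · exact .inr ⟨h0, Sum.inr.inj h ▸ h'⟩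
  · rintro ⟨a, ha, ⟨h0, rfl⟩ | ⟨h0, h⟩⟩
    · exact .inl ⟨a, ha, by simp [h0]⟩
    · exact .inr ⟨_, ⟨a, ha, by simp [h0]⟩, h⟩

end Mem

section Soundness

variable {E V : Type} (S : RegStructure PSym RSym E V)

/-- A value that represents a natural number: the name of an element for zero or for the successor
of a represented number. -/
def RepNat : ℕ → V → Prop
  | 0, a => ∃ e, S.reg .nm e = a ∧ S.pred .zero e
  | n + 1, a => ∃ e, S.reg .nm e = a ∧ S.pred .suc e ∧ RepNat n (S.reg .pd e)

/-- A value that represents a list of natural numbers. -/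
def RepList : List ℕ → V → Prop
  | [], a => ∃ e, S.reg .nm e = a ∧ S.pred .nil e
  | n :: v, a => ∃ e, S.reg .nm e = a ∧ RepNat S n (S.reg .hd e) ∧ RepList v (S.reg .tl e)

variable {S}

theorem RepList.exists_head_tail (hnil : S.Models nilRule) {v : List ℕ} {a : V}
    (h : RepList S v a) :
    ∃ e, S.reg .nm e = a ∧ RepNat S v.headI (S.reg .hd e) ∧ RepList S v.tail (S.reg .tl e) := by
  cases v with
  | cons n v => exact h
  | nil =>
    obtain ⟨e, he, hn⟩ := h
    obtain ⟨h1, d, h2, h3⟩ := hnil e e hn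
    exact ⟨e, he, ⟨d, h2, h3⟩, ⟨e, h1.symm, hn⟩⟩

theorem repNat_of_sat_numeral {k : ℕ} {a b : E} (h : S.Sat a b (numeral k)) :
    RepNat S k (S.reg .nm a) := by
  induction k generalizing a b with
  | zero => exact ⟨a, rfl, h⟩
  | succ k ih =>
    obtain ⟨h1, d, h2, e, h3, h4⟩ := h
    refine ⟨a, rfl, h1, ?_⟩
    have h2 : S.reg .nm d = S.reg .pd a := h2
    have h3 : S.reg .nm e = S.reg .nm d := h3
    rw [← h2, ← h3]
    exact ih h4

/-- In every structure that satisfies the rules, each call of a code on an input where the code has a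
value is done, with a representation of this value as output. -/
theorem done_of_mem_eval (hnil : S.Models nilRule) {c : Code} (hc : ∀ ρ ∈ rules c, S.Models ρ)
    {u v : List ℕ} (h : u ∈ c.eval v) {e : E} (he : S.pred (.call c) e)
    (hv : RepList S v (S.reg .inp e)) :
    S.pred (.done c) e ∧ RepList S u (S.reg .out e) := by
  induction c generalizing u v e with
  | zero' =>
    simp only [rules, List.forall_mem_cons] at hc
    obtain ⟨h1, -⟩ := hc
    obtain ⟨hd, y, hy1, hy2, x, hx1, hx2⟩ := h1 e e he
    obtain rfl : u = 0 :: v := by simpa using h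
    simp only [RegStructure.Sat, cond_true, cond_false] at hy1 hy2 hx1
    exact ⟨hd, y, hy1, ⟨x, hx1, hx2⟩, hy2 ▸ hv⟩
  | succ =>
    simp only [rules, List.forall_mem_cons] at hc
    obtain ⟨h1, h2, -⟩ := hc
    obtain ⟨l, hl1, hl2, -⟩ := hv.exists_head_tail hnil
    have hm : S.reg .mid e = S.reg .hd l := h1 e l ⟨he, hl1⟩
    obtain ⟨hd, y, hy1, hy2, ⟨x, hx1, hx2⟩, z, hz1, hz2, hz3⟩ := h2 e e he
    obtain rfl : u = [v.headI + 1] := by simpa using h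
    simp only [RegStructure.Sat, cond_true, cond_false] at hy1 hy2 hx1 hz1 hz3
    exact ⟨hd, y, hy1, ⟨z, hz1, hz2, by rwa [hz3, hy2, hm]⟩, x, hx1, hx2⟩
  | tail =>
    simp only [rules, List.forall_mem_cons] at hc
    obtain ⟨l, hl1, -, hl2⟩ := hv.exists_head_tail hnil
    obtain ⟨hd, ho⟩ := hc.1 e l ⟨he, hl1⟩
    obtain rfl : u = v.tail := by simpa using h
    have ho : S.reg .out e = S.reg .tl l := ho
    exact ⟨hd, ho ▸ hl2⟩
  | cons f g ihf ihg =>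
    simp only [rules, List.forall_mem_append, List.forall_mem_cons] at hc
    obtain ⟨⟨h1, h2, h3, h4, h5, -⟩, hf, hg⟩ := hc
    obtain ⟨a, ha, b, hb, rfl⟩ := mem_eval_cons.mp h
    obtain ⟨y, hy1, hy2⟩ := h1 e e he
    obtain ⟨z, hz1, hz2⟩ := h2 e e he
    simp only [RegStructure.Sat, cond_true, cond_false] at hy2 hz2
    obtain ⟨hy3, hy4⟩ := ihf hf ha hy1 (hy2 ▸ hv)
    obtain ⟨hz3, hz4⟩ := ihg hg hb hz1 (hz2 ▸ hv)
    obtain ⟨hm1, hm2⟩ := h3 e y ⟨he, hy1, hy3, hy2⟩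
    obtain ⟨l, hl1, hl2, -⟩ := hy4.exists_head_tail hnil
    have hm2 : S.reg .mid e = S.reg .out y := hm2
    have hh : S.reg .mhd e = S.reg .hd l := h4 e l ⟨he, hm1, hl1.trans hm2.symm⟩
    obtain ⟨hd, ht, w, hw1, hw2, hw3⟩ := h5 e z ⟨he, hm1, hz1, hz3, hz2⟩
    simp only [RegStructure.Sat, cond_true, cond_false] at ht hw1 hw2 hw3
    exact ⟨hd, w, hw1, by rwa [hw2, hh], by rwa [hw3, ht]⟩
  | comp f g ihf ihg =>
    simp only [rules, List.forall_mem_append, List.forall_mem_cons] at hc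
    obtain ⟨⟨h1, h2, h3, -⟩, hf, hg⟩ := hc
    obtain ⟨a, ha, hu⟩ := mem_eval_comp.mp h
    obtain ⟨y, hy1, hy2⟩ := h1 e e he
    simp only [RegStructure.Sat, cond_true, cond_false] at hy2
    obtain ⟨hy3, hy4⟩ := ihg hg ha hy1 (hy2 ▸ hv)
    obtain ⟨hm1, hm2, z, hz1, hz2⟩ := h2 e y ⟨he, hy1, hy3, hy2⟩
    simp only [RegStructure.Sat, cond_true, cond_false] at hm2 hz2
    obtain ⟨hz3, hz4⟩ := ihf hf hu (e := z) hz1 (by rwa [hz2, hm2])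
    obtain ⟨hd, ho⟩ := h3 e z ⟨he, hm1, hz1, hz3, hz2⟩
    have ho : S.reg .out e = S.reg .out z := ho
    exact ⟨hd, ho ▸ hz4⟩
  | case f g ihf ihg =>
    simp only [rules, List.forall_mem_append, List.forall_mem_cons] at hc
    obtain ⟨⟨h1, h2, h3, h4, h5, -⟩, hf, hg⟩ := hc
    obtain ⟨l, hl1, hl2, hl3⟩ := hv.exists_head_tail hnil
    obtain ⟨hh, ht⟩ := h1 e l ⟨he, hl1⟩
    simp only [RegStructure.Sat, cond_true, cond_false] at hh ht
    by_cases h0 : v.headI = 0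
    · rw [eval_case_of_eq_zero h0] at h
      rw [h0] at hl2
      obtain ⟨n, hn1, hn2⟩ := hl2
      obtain ⟨hz, y, hy1, hy2⟩ := h2 e n ⟨he, hn1.trans hh.symm, hn2⟩
      simp only [RegStructure.Sat, cond_true, cond_false] at hy2
      obtain ⟨hy3, hy4⟩ := ihf hf h (e := y) hy1 (by rwa [hy2, ht])
      obtain ⟨hd, ho⟩ := h3 e y ⟨he, hz, hy1, hy3, hy2⟩
      have ho : S.reg .out e = S.reg .out y := ho
      exact ⟨hd, ho ▸ hy4⟩
    · rw [eval_case_of_ne_zero h0] at h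
      obtain ⟨m, hm⟩ := Nat.exists_eq_succ_of_ne_zero h0
      rw [hm] at hl2
      obtain ⟨n, hn1, hn2, hn3⟩ := hl2
      obtain ⟨hs, hx, ⟨w, hw1, hw2, hw3⟩, y, hy1, hy2⟩ := h4 e n ⟨he, hn1.trans hh.symm, hn2⟩
      simp only [RegStructure.Sat, cond_true, cond_false] at hx hw1 hw2 hw3 hy2
      obtain ⟨hy3, hy4⟩ := ihg hg h (e := y) hy1 (by
        rw [hy2, hm]
        exact ⟨w, hw1, by rw [hw2, hx]; exact hn3, by rwa [hw3, ht]⟩)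
      obtain ⟨hd, ho⟩ := h5 e y ⟨he, hs, hy1, hy3, hy2⟩
      have ho : S.reg .out e = S.reg .out y := ho
      exact ⟨hd, ho ▸ hy4⟩
  | fix f ihf =>
    simp only [rules, List.forall_mem_append, List.forall_mem_cons] at hc
    obtain ⟨⟨h1, h2, h3, h4, h5, h6, -⟩, hf⟩ := hc
    -- One round of the loop: the output of the body is available in the intermediate registers.
    have round : ∀ {v a : List ℕ} {e : E}, a ∈ f.eval v → S.pred (.call (.fix f)) e →
        RepList S v (S.reg .inp e) → S.pred .mid e ∧ RepNat S a.headI (S.reg .mhd e) ∧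
          RepList S a.tail (S.reg .mtl e) := by
      intro v a e ha he hv
      obtain ⟨y, hy1, hy2⟩ := h1 e e he
      simp only [RegStructure.Sat, cond_true, cond_false] at hy2
      obtain ⟨hy3, hy4⟩ := ihf hf ha hy1 (hy2 ▸ hv)
      obtain ⟨hm1, hm2⟩ := h2 e y ⟨he, hy1, hy3, hy2⟩
      have hm2 : S.reg .mid e = S.reg .out y := hm2
      obtain ⟨l, hl1, hl2, hl3⟩ := hy4.exists_head_tail hnil
      obtain ⟨hh, ht⟩ := h3 e l ⟨he, hm1, hl1.trans hm2.symm⟩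
      simp only [RegStructure.Sat, cond_true, cond_false] at hh ht
      exact ⟨hm1, hh ▸ hl2, ht ▸ hl3⟩
    rw [Code.fix_eval] at h
    revert e
    refine PFun.fixInduction' (C := fun v => ∀ {e : E}, S.pred (.call (.fix f)) e →
      RepList S v (S.reg .inp e) → S.pred (.done (.fix f)) e ∧ RepList S u (S.reg .out e)) h ?_ ?_
    · intro v hv' e he hv
      obtain ⟨a, ha, h⟩ := (Part.mem_map_iff _).mp hv'
      split_ifs at h with h0
      obtain rfl := Sum.inl.inj h
      obtain ⟨hm, hh, ht⟩ := round ha he hv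
      rw [h0] at hh
      obtain ⟨n, hn1, hn2⟩ := hh
      obtain ⟨hd, ho⟩ := h4 e n ⟨he, hm, hn1, hn2⟩
      have ho : S.reg .out e = S.reg .mtl e := ho
      exact ⟨hd, ho ▸ ht⟩
    · intro v v' _ hv' ih e he hv
      obtain ⟨a, ha, h⟩ := (Part.mem_map_iff _).mp hv'
      split_ifs at h with h0
      obtain rfl := Sum.inr.inj h
      obtain ⟨hm, hh, ht⟩ := round ha he hv
      obtain ⟨m, hm'⟩ := Nat.exists_eq_succ_of_ne_zero h0
      rw [hm'] at hh
      obtain ⟨n, hn1, hn2, -⟩ := hh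
      obtain ⟨hs, y, hy1, hy2⟩ := h5 e n ⟨he, hm, hn1, hn2⟩
      simp only [RegStructure.Sat, cond_true, cond_false] at hy2
      obtain ⟨hy3, hy4⟩ := ih hy1 (hy2 ▸ ht)
      obtain ⟨hd, ho⟩ := h6 e y ⟨he, hs, hy1, hy3, hy2⟩
      have ho : S.reg .out e = S.reg .out y := ho
      exact ⟨hd, ho ▸ hy4⟩

theorem exists_goal_of_dom {c : Code} {k : ℕ} (h : (c.eval [k]).Dom)
    (hS : ∀ ρ ∈ program c, S.Models ρ) {a b : E} (hab : S.Sat a b (startCall c k)) :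
    ∃ e, S.pred .goal e := by
  simp only [program, List.forall_mem_cons] at hS
  obtain ⟨h1, h2, h3⟩ := hS
  obtain ⟨ha, hs, y, hy, ⟨x, hx1, hx2⟩, z, hz1, hz2⟩ := hab
  simp only [RegStructure.Sat, cond_true, cond_false] at hy hx1 hz1
  exact ⟨a, h1 a a ⟨hs, (done_of_mem_eval h2 h3 (Part.get_mem h) ha
    ⟨y, hy, hz1 ▸ repNat_of_sat_numeral hz2, x, hx1, hx2⟩).1⟩⟩

end Soundness

section Standard

/-- The elements of the standard structure. -/
inductive Elem : Type
  | call (c : Code) (v : List ℕ)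
  | num (n : ℕ)
  | lst (v : List ℕ)

instance : Countable Elem := by
  have : Countable Code := codeNum_injective.countable
  let f : Elem → (Code × List ℕ) ⊕ ℕ ⊕ List ℕ
    | .call c v => .inl (c, v)
    | .num n => .inr (.inl n)
    | .lst v => .inr (.inr v)
  refine Function.Injective.countable (f := f) ?_
  rintro (_ | _ | _) (_ | _ | _) h <;> simp_all [f]

open Classical in
/-- The value of a code, or the empty list if the code has no value. -/
noncomputable def result (c : Code) (v : List ℕ) : List ℕ :=
  if h : (c.eval v).Dom then (c.eval v).get h else []

theorem result_eq {c : Code} {u v : List ℕ} (h : u ∈ c.eval v) : result c v = u := by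
  have hd : (c.eval v).Dom := Part.dom_iff_mem.mpr ⟨u, h⟩
  rw [result, dif_pos hd]
  exact Part.get_eq_of_mem h hd

theorem result_mem {c : Code} {v : List ℕ} (h : (c.eval v).Dom) : result c v ∈ c.eval v := by
  rw [result, dif_pos h]
  exact Part.get_mem h

/-- The registers in the standard structure; the value `num 0` is used where the register has no
meaning. -/
noncomputable def stdReg : RSym → Elem → Elem
  | .nm, e => e
  | .hd, .lst v => .num v.headI
  | .tl, .lst v => .lst v.tail
  | .pd, .num n => .num (n - 1)
  | .aux, .lst v => .num (v.headI - 1)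
  | .aux, .call _ v => .num (v.headI - 1)
  | .inp, .call _ v => .lst v
  | .out, .call c v => .lst (result c v)
  | .mid, .call .succ v => .num v.headI
  | .mid, .call (.cons f _) v => .lst (result f v)
  | .mid, .call (.comp _ g) v => .lst (result g v)
  | .mid, .call (.case _ _) v => .lst ((v.headI - 1) :: v.tail)
  | .mid, .call (.fix f) v => .lst (result f v)
  | .mhd, .call (.cons f _) v => .num (result f v).headI
  | .mhd, .call (.case _ _) v => .num v.headI
  | .mhd, .call (.fix f) v => .num (result f v).headI
  | .mtl, .call (.cons _ g) v => .lst (result g v)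
  | .mtl, .call (.case _ _) v => .lst v.tail
  | .mtl, .call (.fix f) v => .lst (result f v).tail
  | _, _ => .num 0

/-- The predicates in the standard structure, where the call of `c₀` on `[k]` is marked. -/
def stdPred (c₀ : Code) (k : ℕ) : PSym → Elem → Prop
  | .zero, .num n => n = 0
  | .suc, .num n => n ≠ 0
  | .nil, .lst v => v = []
  | .start, e => e = .call c₀ [k]
  | .mid, .call (.cons f _) v => (f.eval v).Dom
  | .mid, .call (.comp _ g) v => (g.eval v).Dom
  | .mid, .call (.fix f) v => (f.eval v).Dom
  | .ifZero, .call (.case _ _) v => v.headI = 0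
  | .ifSuc, .call (.case _ _) v => v.headI ≠ 0
  | .ifSuc, .call (.fix f) v => (f.eval v).Dom ∧ (result f v).headI ≠ 0
  | .call c, .call d _ => d = c
  | .done c, .call d v => d = c ∧ (c.eval v).Dom
  | _, _ => False

/-- The standard structure, with all calls of all codes on all lists. -/
noncomputable def std (c₀ : Code) (k : ℕ) : RegStructure PSym RSym Elem Elem :=
  ⟨stdPred c₀ k, stdReg⟩

variable (c₀ : Code) (k : ℕ)

theorem stdPred_call {c : Code} {e : Elem} (h : stdPred c₀ k (.call c) e) :
    ∃ v, e = .call c v := by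
  cases e with
  | call d v => exact ⟨v, by rw [show d = c from h]⟩
  | num | lst => exact h.elim

theorem stdPred_zero {e : Elem} (h : stdPred c₀ k .zero e) : e = .num 0 := by
  cases e with
  | num n => exact congrArg _ h
  | call | lst => exact h.elim

theorem stdPred_suc {e : Elem} (h : stdPred c₀ k .suc e) : ∃ n ≠ 0, e = .num n := by
  cases e with
  | num n => exact ⟨n, h, rfl⟩
  | call | lst => exact h.elim

theorem std_spawn {c d : Code} {u v : List ℕ} {r : RSym} {b : Elem}
    (h : stdReg r (.call d v) = .lst u) : (std c₀ k).Sat (.call d v) b (spawn c r) :=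
  ⟨.call c u, rfl, h.symm⟩

theorem std_finished {c d : Code} {u v : List ℕ} {r : RSym} {b : Elem}
    (h : (std c₀ k).Sat (.call d v) b (finished c r)) (hr : stdReg r (.call d v) = .lst u) :
    b = .call c u ∧ (c.eval u).Dom := by
  obtain ⟨h1, h2, h3⟩ := h
  obtain ⟨w, hw⟩ := stdPred_call c₀ k h1
  simp only [cond_true] at hw
  subst hw
  have h3 : Elem.lst w = stdReg r (.call d v) := h3
  rw [hr] at h3
  obtain rfl := Elem.lst.inj h3
  exact ⟨rfl, h2.2⟩

theorem std_models_nilRule : (std c₀ k).Models nilRule := by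
  rintro (_ | _ | v) b h
  · exact h.elim
  · exact h.elim
  · obtain rfl : v = [] := h
    exact ⟨rfl, .num 0, rfl, rfl⟩

theorem std_models_rules (c : Code) : ∀ ρ ∈ rules c, (std c₀ k).Models ρ := by
  induction c with
  | zero' =>
    simp only [rules, List.forall_mem_cons, List.not_mem_nil, IsEmpty.forall_iff, implies_true,
      and_true]
    intro a b h
    obtain ⟨v, rfl⟩ := stdPred_call c₀ k h
    have hv : 0 :: v ∈ Code.zero'.eval v := by simp
    exact ⟨⟨rfl, Part.dom_iff_mem.mpr ⟨_, hv⟩⟩, .lst (0 :: v),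
      congrArg Elem.lst (result_eq hv).symm, rfl, .num 0, rfl, rfl⟩
  | succ =>
    simp only [rules, List.forall_mem_cons, List.not_mem_nil, IsEmpty.forall_iff, implies_true,
      and_true]
    refine ⟨fun a b ⟨h, hb⟩ => ?_, fun a b h => ?_⟩
    · obtain ⟨v, rfl⟩ := stdPred_call c₀ k h
      have hb : b = .lst v := hb
      subst hb
      rfl
    · obtain ⟨v, rfl⟩ := stdPred_call c₀ k h
      have hv : [v.headI + 1] ∈ Code.succ.eval v := by simp
      exact ⟨⟨rfl, Part.dom_iff_mem.mpr ⟨_, hv⟩⟩, .lst [v.headI + 1],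
        congrArg Elem.lst (result_eq hv).symm, rfl, ⟨.lst [], rfl, rfl⟩,
        .num (v.headI + 1), rfl, Nat.succ_ne_zero _, rfl⟩
  | tail =>
    simp only [rules, List.forall_mem_cons, List.not_mem_nil, IsEmpty.forall_iff, implies_true,
      and_true]
    rintro a b ⟨h, hb⟩
    obtain ⟨v, rfl⟩ := stdPred_call c₀ k h
    have hb : b = .lst v := hb
    subst hb
    have hv : v.tail ∈ Code.tail.eval v := by simp
    exact ⟨⟨rfl, Part.dom_iff_mem.mpr ⟨_, hv⟩⟩, congrArg Elem.lst (result_eq hv)⟩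
  | cons f g ihf ihg =>
    simp only [rules, List.forall_mem_append, List.forall_mem_cons, List.not_mem_nil,
      IsEmpty.forall_iff, implies_true, and_true]
    refine ⟨⟨fun a b h => ?_, fun a b h => ?_, fun a b ⟨h, hb⟩ => ?_, fun a b ⟨h, hm, hb⟩ => ?_,
      fun a b ⟨h, hm, hb⟩ => ?_⟩, ihf, ihg⟩ <;> obtain ⟨v, rfl⟩ := stdPred_call c₀ k h
    · exact std_spawn c₀ k rfl
    · exact std_spawn c₀ k rfl
    · obtain ⟨rfl, hd⟩ := std_finished c₀ k hb rfl
      exact ⟨hd, rfl⟩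
    · have hb : b = .lst (result f v) := hb
      subst hb
      rfl
    · obtain ⟨rfl, hd⟩ := std_finished c₀ k hb rfl
      have hv := mem_eval_cons.mpr ⟨_, result_mem hm, _, result_mem hd, rfl⟩
      exact ⟨⟨rfl, Part.dom_iff_mem.mpr ⟨_, hv⟩⟩, rfl, .lst (_ :: _),
        congrArg Elem.lst (result_eq hv).symm, rfl, rfl⟩
  | comp f g ihf ihg =>
    simp only [rules, List.forall_mem_append, List.forall_mem_cons, List.not_mem_nil,
      IsEmpty.forall_iff, implies_true, and_true]
    refine ⟨⟨fun a b h => ?_, fun a b ⟨h, hb⟩ => ?_, fun a b ⟨h, hm, hb⟩ => ?_⟩, ihf, ihg⟩ <;>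
      obtain ⟨v, rfl⟩ := stdPred_call c₀ k h
    · exact std_spawn c₀ k rfl
    · obtain ⟨rfl, hd⟩ := std_finished c₀ k hb rfl
      exact ⟨hd, rfl, std_spawn c₀ k rfl⟩
    · obtain ⟨rfl, hd⟩ := std_finished c₀ k hb rfl
      have hv := mem_eval_comp.mpr ⟨_, result_mem hm, result_mem hd⟩
      exact ⟨⟨rfl, Part.dom_iff_mem.mpr ⟨_, hv⟩⟩, congrArg Elem.lst (result_eq hv)⟩
  | case f g ihf ihg =>
    simp only [rules, List.forall_mem_append, List.forall_mem_cons, List.not_mem_nil,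
      IsEmpty.forall_iff, implies_true, and_true]
    refine ⟨⟨fun a b ⟨h, hb⟩ => ?_, fun a b ⟨h, hb, h0⟩ => ?_, fun a b ⟨h, hm, hb⟩ => ?_,
      fun a b ⟨h, hb, h0⟩ => ?_, fun a b ⟨h, hm, hb⟩ => ?_⟩, ihf, ihg⟩ <;>
      obtain ⟨v, rfl⟩ := stdPred_call c₀ k h
    · have hb : b = .lst v := hb
      subst hb
      exact ⟨rfl, rfl⟩
    · obtain rfl : b = .num 0 := stdPred_zero c₀ k h0
      have hb : Elem.num 0 = .num v.headI := hb
      exact ⟨(Elem.num.inj hb).symm, std_spawn c₀ k rfl⟩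
    · obtain ⟨rfl, hd⟩ := std_finished c₀ k hb rfl
      have hv := result_mem hd
      rw [← eval_case_of_eq_zero (f := f) (g := g) hm] at hv
      exact ⟨⟨rfl, Part.dom_iff_mem.mpr ⟨_, hv⟩⟩, congrArg Elem.lst (result_eq hv)⟩
    · obtain ⟨n, hn, rfl⟩ : ∃ n ≠ 0, b = .num n := stdPred_suc c₀ k h0
      have hb : Elem.num n = .num v.headI := hb
      obtain rfl := Elem.num.inj hb
      exact ⟨hn, rfl, ⟨.lst (_ :: _), rfl, rfl, rfl⟩, std_spawn c₀ k rfl⟩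
    · obtain ⟨rfl, hd⟩ := std_finished c₀ k hb rfl
      have hv := result_mem hd
      rw [← eval_case_of_ne_zero (f := f) (g := g) hm] at hv
      exact ⟨⟨rfl, Part.dom_iff_mem.mpr ⟨_, hv⟩⟩, congrArg Elem.lst (result_eq hv)⟩
  | fix f ihf =>
    simp only [rules, List.forall_mem_append, List.forall_mem_cons, List.not_mem_nil,
      IsEmpty.forall_iff, implies_true, and_true]
    refine ⟨⟨fun a b h => ?_, fun a b ⟨h, hb⟩ => ?_, fun a b ⟨h, hm, hb⟩ => ?_,
      fun a b ⟨h, hm, hb, h0⟩ => ?_, fun a b ⟨h, hm, hb, h0⟩ => ?_,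
      fun a b ⟨h, hm, hb⟩ => ?_⟩, ihf⟩ <;>
      obtain ⟨v, rfl⟩ := stdPred_call c₀ k h
    · exact std_spawn c₀ k rfl
    · obtain ⟨rfl, hd⟩ := std_finished c₀ k hb rfl
      exact ⟨hd, rfl⟩
    · have hb : b = .lst (result f v) := hb
      subst hb
      exact ⟨rfl, rfl⟩
    · obtain rfl : b = .num 0 := stdPred_zero c₀ k h0
      have hb : Elem.num 0 = .num (result f v).headI := hb
      have hv := mem_eval_fix.mpr ⟨_, result_mem hm, .inl ⟨(Elem.num.inj hb).symm, rfl⟩⟩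
      exact ⟨⟨rfl, Part.dom_iff_mem.mpr ⟨_, hv⟩⟩, congrArg Elem.lst (result_eq hv)⟩
    · obtain ⟨n, hn, rfl⟩ : ∃ n ≠ 0, b = .num n := stdPred_suc c₀ k h0
      have hb : Elem.num n = .num (result f v).headI := hb
      obtain rfl := Elem.num.inj hb
      exact ⟨⟨hm, hn⟩, std_spawn c₀ k rfl⟩
    · obtain ⟨rfl, hd⟩ := std_finished c₀ k hb rfl
      have hv := mem_eval_fix.mpr ⟨_, result_mem hm.1, .inr ⟨hm.2, result_mem hd⟩⟩
      exact ⟨⟨rfl, Part.dom_iff_mem.mpr ⟨_, hv⟩⟩, congrArg Elem.lst (result_eq hv)⟩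

theorem std_models_program {c : Code} (h : ¬ (c.eval [k]).Dom) :
    ∀ ρ ∈ program c, (std c k).Models ρ := by
  refine List.forall_mem_cons.mpr ⟨?_, List.forall_mem_cons.mpr
    ⟨std_models_nilRule c k, std_models_rules c k c⟩⟩
  rintro a b ⟨rfl, -, hd⟩
  exact absurd hd h

theorem std_sat_numeral (n : ℕ) (b : Elem) : (std c₀ k).Sat (.num n) b (numeral n) := by
  induction n generalizing b with
  | zero => rfl
  | succ n ih => exact ⟨Nat.succ_ne_zero _, .num n, rfl, .num n, rfl, ih _⟩

theorem std_sat_startCall (b : Elem) :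
    (std c₀ k).Sat (.call c₀ [k]) b (startCall c₀ k) :=
  ⟨rfl, rfl, .lst [k], rfl, ⟨.lst [], rfl, rfl⟩, .num k, rfl, std_sat_numeral c₀ k k _⟩

end Standard

/-- The entailment from the rules for `c` and the input `[k]` is valid if and only if `c` has a
value on `[k]`. -/
theorem entailment_mem_QLC_iff (c : Code) (k : ℕ) :
    Pos.entailment letter .goal (program c) (startCall c k) ∈ QLC ↔ (c.eval [k]).Dom := by
  constructor
  · intro h
    by_contra hd
    exact (std c k).not_mem_QLC letter_injective (by rintro (_ | _ | _) <;> exact id)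
      (std_models_program k hd) (std_sat_startCall c k (.num 0)) h
  · intro hd
    by_contra h
    obtain ⟨E, V, S, hg, hS, a, b, hab⟩ := exists_regStructure_of_not_mem_QLC h
    exact (exists_goal_of_dom hd hS hab).elim hg

end Eval

/-! ### The reduction -/

namespace Eval

theorem exists_code_of_rePred {p : ℕ → Prop} (hp : REPred p) :
    ∃ c : Turing.ToPartrec.Code, ∀ k, (c.eval [k]).Dom ↔ p k := by
  have h : Partrec fun k => (Part.assert (p k) fun _ => Part.some ()).map fun _ => 0 :=
    Partrec.map hp ((Computable.const 0).to₂)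
  obtain ⟨c, hc⟩ := Turing.ToPartrec.Code.exists_code (Nat.Partrec'.part_iff₁.mpr h)
  refine ⟨c, fun k => ?_⟩
  have := hc ⟨[k], rfl⟩
  rw [show c.eval [k] = _ from this]
  simp [List.Vector.head, Part.assert, Part.some]

theorem primrec_code_and {θ η : ℕ → EPos} (h1 : Primrec fun k => ((θ k).toFormula letter).code)
    (h2 : Primrec fun k => ((η k).toFormula letter).code) :
    Primrec fun k => (((θ k).and (η k)).toFormula letter).code :=
  primrec_natPair (.const 2) (primrec_natPair h1 h2)

theorem primrec_code_ex {θ : ℕ → EPos} (x : Bool)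
    (h : Primrec fun k => ((θ k).toFormula letter).code) :
    Primrec fun k => ((Pos.ex x (θ k)).toFormula letter).code :=
  primrec_natPair (.const 6) (primrec_natPair (.const x.toNat) h)

theorem primrec_code_numeral : Primrec fun k => ((numeral k).toFormula letter).code := by
  let F : ℕ → ℕ := fun n => Nat.pair 2 (Nat.pair ((is .suc X).toFormula letter).code
    (Nat.pair 6 (Nat.pair 1 (Nat.pair 2 (Nat.pair ((same .nm Y .pd X).toFormula letter).code
      (Nat.pair 6 (Nat.pair 0 (Nat.pair 2
        (Nat.pair ((same .nm X .nm Y).toFormula letter).code n)))))))))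
  have hF : Primrec F := primrec_natPair (.const 2) (primrec_natPair (.const _)
    (primrec_natPair (.const 6) (primrec_natPair (.const 1) (primrec_natPair (.const 2)
      (primrec_natPair (.const _) (primrec_natPair (.const 6) (primrec_natPair (.const 0)
        (primrec_natPair (.const 2) (primrec_natPair (.const _) Primrec.id)))))))))
  refine (Primrec.nat_rec₁ ((is .zero X).toFormula letter).code
    (hF.comp Primrec.snd).to₂).of_eq fun k => ?_
  induction k with
  | zero => rfl
  | succ k ih => exact congrArg F ih

theorem primrec_code_startCall (c : Turing.ToPartrec.Code) :
    Primrec fun k => ((startCall c k).toFormula letter).code :=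
  primrec_code_and (.const _) (primrec_code_and (.const _) (primrec_code_ex Y
    (primrec_code_and (.const _) (primrec_code_and (.const _) (primrec_code_ex X
      (primrec_code_and (.const _) primrec_code_numeral))))))

theorem manyOneReducible {p : ℕ → Prop} (hp : REPred p) {Γ : Set Formula}
    (hΓ : ∀ φ : Formula, φ.TwoVarUnary → (φ ∈ Γ ↔ φ ∈ QLC)) :
    ManyOneReducible p (fun k : ℕ => k ∈ Formula.code '' Γ) := by
  obtain ⟨c, hc⟩ := exists_code_of_rePred hp
  let φ : ℕ → Formula := fun k => Pos.entailment letter .goal (program c) (startCall c k)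
  refine ⟨fun k => (φ k).code, Primrec.to_comp ?_, fun k => ?_⟩
  · exact primrec_natPair (.const 4) (primrec_natPair (primrec_natPair (.const 2)
      (primrec_natPair (.const _) (primrec_natPair (.const 6) (primrec_natPair (.const 0)
        (primrec_natPair (.const 6) (primrec_natPair (.const 1) (primrec_code_startCall c)))))))
      (.const _))
  · change p k ↔ (φ k).code ∈ Formula.code '' Γ
    rw [Formula.code_injective.mem_set_image, hΓ _ (Pos.twoVarUnary_entailment _ _ _),
      entailment_mem_QLC_iff, hc]

end Eval

end IntPred

theorem theorem1 :
    IntPred.SigmaOneComplete (IntPred.QLC ∩ IntPred.twoVariable) ∧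
      IntPred.SigmaOneComplete
        (IntPred.QLC ∩ IntPred.twoVariable ∩ IntPred.oneBinaryRestUnary) := by
  refine ⟨⟨IntPred.rePred_QLC_twoVariable, fun p hp => IntPred.Eval.manyOneReducible hp ?_⟩,
    ⟨IntPred.rePred_QLC_twoVariable_letters, fun p hp => IntPred.Eval.manyOneReducible hp ?_⟩⟩
  · exact fun φ hφ => ⟨fun h => h.1, fun h => ⟨h, hφ.1⟩⟩
  · exact fun φ hφ => ⟨fun h => h.1.1, fun h => ⟨⟨h, hφ.1⟩, fun q hq => .inl (hφ.2 q hq)⟩⟩
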